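/- Let $\mathrm{Ai}(x)=\frac1\pi\int_0^\infty\cos\bigl(\frac{t^3}{3}+xt\bigr)\,dt$ be the Airy function of the first kind. For real $c$ let $$\mathcal T_c[f](x)=\int_0^\infty \mathrm{Ai}(x+y+c)f(y)\,dy \quad (x\ge 0),\qquad \mathcal L_c[f](x)=-\frac{d}{dx}\Bigl(x\frac{df}{dx}\Bigr)+x(x+c)f(x)$$ be the Airy integral operator on $L^2[0,\infty)$ and the differential operator commuting with it. Let $\lambda_{0,c},\lambda_{1,c},\dots$ be the eigenvalues of $\mathcal T_c$, listed with multiplicity so that $|\lambda_{0,c}|\ge|\lambda_{1,c}|\ge\cdots$, and let $\psi_{0,c},\psi_{1,c},\dots$ be corresponding real eigenfunctions, orthonormal in $L^2[0,\infty)$, with $\lambda_{n,c}\psi_{n,c}(x)=\mathcal T_c[\psi_{n,c}](x)$ for every $x\ge 0$. Then every $\psi_{n,c}$ is smooth on $[0,\infty)$ (derivatives at $0$ being one-sided), and there is exactly one real number $\chi_{n,c}$ with $\mathcal L_c[\psi_{n,c}]=\chi_{n,c}\psi_{n,c}$ on $[0,\infty)$. For all real $c$, all integers $n\ge0$ and all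 $x\in[0,\infty)$: 1. for all integers $k\ge2$, $$-k(k-1)\psi_{n,c}^{(k-2)}(x)-k(c+2x)\psi_{n,c}^{(k-1)}(x)+(\chi_{n,c}-cx-x^2)\psi_{n,c}^{(k)}(x)+(k+1)\psi_{n,c}^{(k+1)}(x)+x\,\psi_{n,c}^{(k+2)}(x)=0;$$ 2. $$-(c+2x)\psi_{n,c}(x)+(\chi_{n,c}-cx-x^2)\psi_{n,c}'(x)+2\psi_{n,c}''(x)+x\,\psi_{n,c}^{(3)}(x)=0;$$ 3. in particular, $\chi_{n,c}\psi_{n,c}(0)+\psi_{n,c}'(0)=0$; 4. if $c>0$, then $\psi_{n,c}(0)\ne0$. -/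

import Mathlib

open scoped ContDiff

/-- The Airy function of the first kind,
`Ai x = (1/π) ∫₀^∞ cos (t³/3 + x t) dt`. The integral converges only conditionally, so it is
the limit of the integrals over `[0, R]`. -/
noncomputable def airyAi (x : ℝ) : ℝ :=
  (1 / Real.pi) *
    Filter.limUnder Filter.atTop (fun R : ℝ => ∫ t in (0 : ℝ)..R, Real.cos (t ^ 3 / 3 + x * t))

/-- The Airy integral operator `T_c[f](x) = ∫₀^∞ Ai(x + y + c) f(y) dy`. -/
noncomputable def airyT (c : ℝ) (f : ℝ → ℝ) (x : ℝ) : ℝ :=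
  ∫ y in Set.Ici (0 : ℝ), airyAi (x + y + c) * f y

/-- The commuting differential operator `L_c[f](x) = -(x f'(x))' + x (x + c) f(x)` on the half-line
`[0, ∞)`; derivatives are taken within the half-line, hence one-sided at `0`. -/
noncomputable def airyL (c : ℝ) (f : ℝ → ℝ) (x : ℝ) : ℝ :=
  - derivWithin (fun t => t * derivWithin f (Set.Ici 0) t) (Set.Ici 0) x + x * (x + c) * f x

/-- `f` is an eigenfunction of `T_c` on `L²[0, ∞)` with eigenvalue `μ`; the representative `f`
satisfies the eigenvalue equation at every point of `[0, ∞)`. -/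
structure IsAiryEigenfunction (c μ : ℝ) (f : ℝ → ℝ) : Prop where
  memLp : MeasureTheory.MemLp f 2 (MeasureTheory.volume.restrict (Set.Ici 0))
  ne_zero : ¬ (f =ᵐ[MeasureTheory.volume.restrict (Set.Ici 0)] 0)
  eigen : ∀ x, 0 ≤ x → μ * f x = airyT c f x

/-- `lam n`, `ψ n` are the `(n+1)`-th eigenvalue and eigenfunction of `T_c`: the eigenvalues are
listed with multiplicity in order of non-increasing absolute value, the eigenfunctions are
orthonormal in `L²[0, ∞)`, and the list misses none (no eigenfunction is orthogonal
to every `ψ n`). -/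
structure IsAiryEigensystem (c : ℝ) (lam : ℕ → ℝ) (ψ : ℕ → ℝ → ℝ) : Prop where
  antitone_abs : Antitone (fun n => |lam n|)
  eigenfunction : ∀ n, IsAiryEigenfunction c (lam n) (ψ n)
  orthonormal : ∀ m n, ∫ x in Set.Ici (0 : ℝ), ψ m x * ψ n x = if m = n then 1 else 0
  exhaustive : ∀ (μ : ℝ) (f : ℝ → ℝ), IsAiryEigenfunction c μ f →
    ∃ n, ∫ x in Set.Ici (0 : ℝ), f x * ψ n x ≠ 0

/-- `χ n` is the eigenvalue of `L_c` belonging to `ψ n`: `L_c[ψ n] = χ n • ψ n` on `[0, ∞)`. -/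
def IsAiryChi (c : ℝ) (ψ : ℕ → ℝ → ℝ) (χ : ℕ → ℝ) : Prop :=
  ∀ n x, 0 ≤ x → airyL c (ψ n) x = χ n * ψ n x

/-- The `k`-th derivative on the half-line `[0, ∞)`, one-sided at `0`. -/
noncomputable def halfLineDeriv (k : ℕ) (f : ℝ → ℝ) (x : ℝ) : ℝ :=
  iteratedDerivWithin k f (Set.Ici 0) x

open MeasureTheory Set Filter Topology

/-! The heart of the matter is that `T_c` and `L_c` commute and that no eigenfunction of `T_c`
vanishes at `0`. Simplicity of the eigenvalues follows: if `f`, `g` share an eigenvalue, then `f(0)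
g - g(0) f` vanishes at `0`, hence everywhere on the half-line. So `L_c f`, which lies in the same
eigenspace as `f`, is a multiple `χ f`. The identities are the derivatives of this differential
equation.

Moving the Airy integral to a line in the upper half-plane gives smoothness, the equation `Ai'' = x
Ai` and decay faster than any exponential. If `T_c f = 0`, differentiating repeatedly shows that all
moments of `Ai(y + c) f` and `Ai'(y + c) f` vanish; as `Ai` and `Ai'` have no common zero, `f = 0`
(`ae_eq_zero_of_airyOp_eq_zero`). Hence eigenvalues are nonzero, and the eigenvalue equation extends
each eigenfunction smoothly to the line.

Nonvanishing at `0` (`eq_zero_of_zero`) has two ingredients. The first is `wronskian_zero`: two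
eigenfunctions with the same eigenvalue have zero Wronskian at `0`. Applied to `f` and `L_c f`,
whose value at `0` is `-f'(0)`, it shows that `f(0) = 0` forces `f'(0) = 0`, so all iterates `u_n =
L_c^n f` vanish at `0`. The second is that `L_c` is bounded on the eigenspace (`exists_bound`), so
`u_n` grows at most geometrically. Integrating `(x u_n')' = x (x + c) u_n - u_{n+1}` again and again
gains a factor of the size `x / j` at step `j`, which forces `f = 0`. -/

/-! ### The Airy function as a contour integral -/

/-- The integrand of the Airy contour integral, on the horizontal line of height `e`. -/
noncomputable def airyPhase (x : ℝ) (z : ℂ) : ℂ :=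
  Complex.exp (Complex.I * (z ^ 3 / 3 + x * z))

noncomputable def airyLine (e t : ℝ) : ℂ := (t : ℂ) + (e : ℂ) * Complex.I

/-- The `k`-th derivative of `2 π Ai`, as an integral over the horizontal line of height `e`. -/
noncomputable def airyContour (k : ℕ) (e x : ℝ) : ℂ :=
  ∫ t : ℝ, (Complex.I * airyLine e t) ^ k * airyPhase x (airyLine e t)

lemma norm_airyPhase_airyLine (e x t : ℝ) :
    ‖airyPhase x (airyLine e t)‖ = Real.exp (-(e * t ^ 2) + e ^ 3 / 3 - x * e) := by
  rw [airyPhase, Complex.norm_exp]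
  congr 1
  have : Complex.I * (airyLine e t ^ 3 / 3 + x * airyLine e t)
      = ((-(e * t ^ 2) + e ^ 3 / 3 - x * e : ℝ) : ℂ)
        + ((t ^ 3 / 3 - t * e ^ 2 + x * t : ℝ) : ℂ) * Complex.I := by
    have h3 : Complex.I ^ 3 = -Complex.I := by rw [pow_succ, Complex.I_sq]; ring
    have h4 : Complex.I ^ 4 = 1 := by simp
    simp only [airyLine]
    push_cast
    ring_nf
    simp only [h3, h4, Complex.I_sq]
    ring
  rw [this]
  simp [-Complex.ofReal_add, -Complex.ofReal_sub]

lemma norm_airyLine_le (e t : ℝ) (he : 0 ≤ e) : ‖airyLine e t‖ ≤ |t| + e := by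
  refine (norm_add_le _ _).trans ?_
  simp [abs_of_nonneg he]

@[fun_prop]
lemma continuous_airyLine (e : ℝ) : Continuous (airyLine e) := by
  unfold airyLine; fun_prop

@[fun_prop]
lemma continuous_airyPhase (x : ℝ) : Continuous (airyPhase x) := by
  unfold airyPhase; fun_prop

/-- On the line of height `e` the phase has Gaussian size `exp (-e t²)`. Half of this Gaussian
absorbs the polynomial factor, which is estimated by `‖z‖^k ≤ k! exp ‖z‖`. -/
lemma exists_airyIntegrand_bound (k : ℕ) {e : ℝ} (he : 0 < e) :
    ∃ C, 0 ≤ C ∧ ∀ x t : ℝ, ‖(Complex.I * airyLine e t) ^ k * airyPhase x (airyLine e t)‖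
      ≤ C * Real.exp (-(e * x)) * Real.exp (-(e / 2) * t ^ 2) := by
  refine ⟨k.factorial * Real.exp (e + 1 / (2 * e) + e ^ 3 / 3), by positivity, fun x t => ?_⟩
  rw [norm_mul, norm_pow, norm_mul, Complex.norm_I, one_mul, norm_airyPhase_airyLine]
  have h1 : ‖airyLine e t‖ ^ k ≤ k.factorial * Real.exp (|t| + e) := by
    have := Real.pow_div_factorial_le_exp ‖airyLine e t‖ (norm_nonneg _) k
    rw [div_le_iff₀ (by positivity)] at this
    have h2 := Real.exp_le_exp.2 (norm_airyLine_le e t he.le)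
    rw [mul_comm]
    exact this.trans (by gcongr)
  have h3 : |t| ≤ e / 2 * t ^ 2 + 1 / (2 * e) := by
    have : e / 2 * t ^ 2 + 1 / (2 * e) - |t| = (e * |t| - 1) ^ 2 / (2 * e) := by
      rw [← sq_abs t]; field_simp; ring
    have h4 : 0 ≤ (e * |t| - 1) ^ 2 / (2 * e) := by positivity
    linarith
  calc _ ≤ (k.factorial * Real.exp (|t| + e)) * Real.exp (-(e * t ^ 2) + e ^ 3 / 3 - x * e) := by
        gcongr
    _ = k.factorial * Real.exp (|t| + e + (-(e * t ^ 2) + e ^ 3 / 3 - x * e)) := by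
        rw [mul_assoc, ← Real.exp_add]
    _ ≤ k.factorial * Real.exp ((e + 1 / (2 * e) + e ^ 3 / 3) + -(e * x) + -(e / 2) * t ^ 2) := by
        gcongr ?_ * Real.exp ?_
        nlinarith
    _ = _ := by rw [Real.exp_add, Real.exp_add]; ring

lemma integrable_airyIntegrand (k : ℕ) {e : ℝ} (he : 0 < e) (x : ℝ) :
    Integrable (fun t : ℝ => (Complex.I * airyLine e t) ^ k * airyPhase x (airyLine e t)) := by
  obtain ⟨C, -, hC⟩ := exists_airyIntegrand_bound k he
  refine Integrable.mono' ((integrable_exp_neg_mul_sq (half_pos he)).const_mul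
    (C * Real.exp (-(e * x)))) (Continuous.aestronglyMeasurable (by fun_prop)) ?_
  exact Eventually.of_forall fun t => hC x t

lemma exists_airyContour_bound (k : ℕ) {e : ℝ} (he : 0 < e) :
    ∃ C, 0 ≤ C ∧ ∀ x : ℝ, ‖airyContour k e x‖ ≤ C * Real.exp (-(e * x)) := by
  obtain ⟨C, hC0, hC⟩ := exists_airyIntegrand_bound k he
  refine ⟨C * ∫ t : ℝ, Real.exp (-(e / 2) * t ^ 2),
    mul_nonneg hC0 (integral_nonneg fun t => (Real.exp_pos _).le), fun x => ?_⟩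
  have := norm_integral_le_of_norm_le ((integrable_exp_neg_mul_sq (half_pos he)).const_mul
    (C * Real.exp (-(e * x)))) (Eventually.of_forall fun t => hC x t)
  rw [integral_const_mul] at this
  refine this.trans (le_of_eq (by ring))

lemma hasDerivAt_airyContour (k : ℕ) {e : ℝ} (he : 0 < e) (x : ℝ) :
    HasDerivAt (airyContour k e) (airyContour (k + 1) e x) x := by
  obtain ⟨C, hC0, hC⟩ := exists_airyIntegrand_bound (k + 1) he
  refine (hasDerivAt_integral_of_dominated_loc_of_deriv_le (𝕜 := ℝ)
    (F := fun x t => (Complex.I * airyLine e t) ^ k * airyPhase x (airyLine e t))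
    (F' := fun x t => (Complex.I * airyLine e t) ^ (k + 1) * airyPhase x (airyLine e t))
    (bound := fun t => C * Real.exp (-(e * (x - 1))) * Real.exp (-(e / 2) * t ^ 2))
    (Ioi_mem_nhds (show x - 1 < x by linarith)) ?_ (integrable_airyIntegrand k he x) ?_ ?_ ?_
    ?_).2
  · exact Eventually.of_forall fun y => Continuous.aestronglyMeasurable (by fun_prop)
  · exact Continuous.aestronglyMeasurable (by fun_prop)
  · refine Eventually.of_forall fun t y hy => (hC y t).trans ?_
    have : x - 1 < y := hy
    gcongr
  · exact (integrable_exp_neg_mul_sq (half_pos he)).const_mul _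
  · refine Eventually.of_forall fun t y _ => ?_
    have h0 : HasDerivAt (fun y : ℝ => (y : ℂ)) 1 y := Complex.ofRealCLM.hasDerivAt
    have h1 : HasDerivAt (fun y : ℝ => Complex.I * (airyLine e t ^ 3 / 3 + y * airyLine e t))
        (Complex.I * (1 * airyLine e t)) y :=
      ((h0.mul_const _).const_add _).const_mul _
    have := h1.cexp.const_mul ((Complex.I * airyLine e t) ^ k)
    refine this.congr_deriv ?_
    simp only [airyPhase]; ring

/-- Along the line the derivative of the phase is `i (z² + x)` times the phase, and its integral is
zero. -/
lemma airyContour_two {e : ℝ} (he : 0 < e) (x : ℝ) :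
    airyContour 2 e x = x * airyContour 0 e x := by
  have hd : ∀ t : ℝ, HasDerivAt (fun t => airyPhase x (airyLine e t))
      (Complex.I * (airyLine e t ^ 2 + x) * airyPhase x (airyLine e t)) t := by
    intro t
    have h0 : HasDerivAt (airyLine e) 1 t :=
      (Complex.ofRealCLM.hasDerivAt (x := t)).add_const _
    have h1 := ((((h0.pow 3).div_const 3).add (h0.const_mul (x : ℂ))).const_mul Complex.I).cexp
    refine h1.congr_deriv ?_
    simp only [airyPhase, Pi.add_apply, Pi.pow_apply]; push_cast; ring
  have e0 := integrable_airyIntegrand 0 he x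
  have e2 := integrable_airyIntegrand 2 he x
  have heq : ∀ t : ℝ, Complex.I * (airyLine e t ^ 2 + x) * airyPhase x (airyLine e t)
      = (-Complex.I) * ((Complex.I * airyLine e t) ^ 2 * airyPhase x (airyLine e t))
        + (Complex.I * x) * ((Complex.I * airyLine e t) ^ 0 * airyPhase x (airyLine e t)) := by
    intro t
    rw [mul_pow, Complex.I_sq]; ring
  have := integral_eq_zero_of_hasDerivAt_of_integrable hd
    (by simp_rw [heq]; exact (e2.const_mul _).add (e0.const_mul _)) (by simpa using e0)
  simp_rw [heq] at this
  rw [integral_add (e2.const_mul _) (e0.const_mul _), integral_const_mul, integral_const_mul] at this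
  change -Complex.I * airyContour 2 e x + Complex.I * x * airyContour 0 e x = 0 at this
  have h2 : Complex.I * (airyContour 2 e x - x * airyContour 0 e x) = 0 := by
    linear_combination -this
  simpa [sub_eq_zero] using h2

lemma integral_airyPhase_symm (x R : ℝ) :
    ∫ t in (-R)..R, airyPhase x t = ((2 * ∫ t in (0 : ℝ)..R, Real.cos (t ^ 3 / 3 + x * t) : ℝ) : ℂ) := by
  have hc : Continuous fun t : ℝ => airyPhase x t := by fun_prop
  rw [← intervalIntegral.integral_add_adjacent_intervals (hc.intervalIntegrable (-R) 0)
    (hc.intervalIntegrable 0 R)]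
  have h1 : ∫ t in (-R)..0, airyPhase x t = ∫ t in (0 : ℝ)..R, airyPhase x (-t : ℝ) := by
    rw [intervalIntegral.integral_comp_neg (f := fun t : ℝ => airyPhase x t)]; simp
  rw [h1, ← intervalIntegral.integral_add (Continuous.intervalIntegrable (by fun_prop) _ _)
    (hc.intervalIntegrable 0 R), ← intervalIntegral.integral_const_mul,
    ← intervalIntegral.integral_ofReal]
  congr 1
  ext t
  simp only [airyPhase]
  push_cast
  rw [Complex.cos]
  ring_nf

/-- Cauchy's theorem on a rectangle of height `e`. On the vertical sides the integrand is bounded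
uniformly in `R` and tends to zero at each height `y > 0`, so they disappear in the limit. -/
lemma tendsto_integral_airyPhase {e : ℝ} (he : 0 < e) (x : ℝ) :
    Tendsto (fun R : ℝ => ∫ t in (-R)..R, airyPhase x t) atTop (𝓝 (airyContour 0 e x)) := by
  have hline : Tendsto (fun R : ℝ => ∫ t in (-R)..R, airyPhase x (airyLine e t)) atTop
      (𝓝 (airyContour 0 e x)) := by
    have := intervalIntegral_tendsto_integral (integrable_airyIntegrand 0 he x)
      tendsto_neg_atTop_atBot tendsto_id
    simpa [airyContour] using this
  have hside : ∀ s : ℝ, s = 1 ∨ s = -1 →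
      Tendsto (fun R : ℝ => ∫ y in (0 : ℝ)..e, airyPhase x (airyLine y (s * R))) atTop (𝓝 0) := by
    intro s hs
    have := intervalIntegral.tendsto_integral_filter_of_dominated_convergence
      (μ := volume) (a := 0) (b := e) (l := (atTop : Filter ℝ))
      (F := fun (R y : ℝ) => airyPhase x (airyLine y (s * R))) (f := fun _ => (0 : ℂ))
      (fun y => Real.exp (e ^ 3 / 3 + |x| * e)) ?_ ?_ ?_ ?_
    · simpa using this
    · refine Eventually.of_forall fun R => Continuous.aestronglyMeasurable ?_
      unfold airyLine; fun_prop
    · refine Eventually.of_forall fun R => Eventually.of_forall fun y hy => ?_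
      rw [uIoc_of_le he.le] at hy
      rw [norm_airyPhase_airyLine]
      apply Real.exp_le_exp.2
      have h1 : y ^ 3 ≤ e ^ 3 := pow_le_pow_left₀ hy.1.le hy.2 3
      have h2 : 0 ≤ y * (s * R) ^ 2 := mul_nonneg hy.1.le (sq_nonneg _)
      have h3 : -(x * y) ≤ |x| * e := by
        calc -(x * y) = (-x) * y := by ring
          _ ≤ |x| * y := by gcongr; exacts [hy.1.le, neg_le_abs x]
          _ ≤ |x| * e := by gcongr; exact hy.2
      linarith
    · exact intervalIntegrable_const
    · refine Eventually.of_forall fun y hy => ?_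
      rw [uIoc_of_le he.le] at hy
      rw [tendsto_zero_iff_norm_tendsto_zero]
      simp_rw [norm_airyPhase_airyLine]
      apply Real.tendsto_exp_atBot.comp
      have hs2 : s ^ 2 = 1 := by rcases hs with rfl | rfl <;> norm_num
      have : Tendsto (fun R : ℝ => y * R ^ 2) atTop atTop :=
        (tendsto_pow_atTop two_ne_zero).const_mul_atTop hy.1
      have h2 := (tendsto_neg_atTop_atBot.comp this).atBot_add
        (tendsto_const_nhds (x := y ^ 3 / 3 - x * y))
      refine h2.congr fun R => ?_
      simp only [Function.comp, mul_pow, hs2]; ring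
  have key : ∀ R : ℝ, ∫ t in (-R)..R, airyPhase x t
      = (∫ t in (-R)..R, airyPhase x (airyLine e t))
        - Complex.I * (∫ y in (0 : ℝ)..e, airyPhase x (airyLine y (1 * R)))
        + Complex.I * (∫ y in (0 : ℝ)..e, airyPhase x (airyLine y (-1 * R))) := by
    intro R
    have hdiff : Differentiable ℂ (airyPhase x) := by unfold airyPhase; fun_prop
    have := Complex.integral_boundary_rect_eq_zero_of_differentiableOn (airyPhase x)
      ((-R : ℝ) : ℂ) ((R : ℂ) + (e : ℂ) * Complex.I) hdiff.differentiableOn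
    simp only [Complex.ofReal_re, Complex.ofReal_im, Complex.add_re, Complex.mul_re, Complex.I_re,
      Complex.I_im, Complex.add_im, Complex.mul_im, smul_eq_mul, mul_zero, mul_one, zero_mul,
      sub_zero, add_zero, zero_add, Complex.ofReal_zero] at this
    simp only [airyLine, one_mul, neg_one_mul]
    linear_combination this
  simp_rw [key]
  simpa using (hline.sub ((hside 1 (Or.inl rfl)).const_mul Complex.I)).add
    ((hside (-1) (Or.inr rfl)).const_mul Complex.I)

lemma airyContour_zero {e : ℝ} (he : 0 < e) (x : ℝ) :
    airyContour 0 e x = ((2 * Real.pi * airyAi x : ℝ) : ℂ) := by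
  have h1 := tendsto_integral_airyPhase he x
  simp_rw [integral_airyPhase_symm] at h1
  have h2 : Tendsto (fun R : ℝ => ∫ t in (0 : ℝ)..R, Real.cos (t ^ 3 / 3 + x * t)) atTop
      (𝓝 ((airyContour 0 e x).re / 2)) := by
    have := ((Complex.continuous_re.tendsto _).comp h1).div_const 2
    refine this.congr fun R => ?_
    simp
  have h3 : airyAi x = 1 / Real.pi * ((airyContour 0 e x).re / 2) := by
    rw [airyAi, h2.limUnder_eq]
  have h4 : (airyContour 0 e x).im = 0 := by
    have := (Complex.continuous_im.tendsto _).comp h1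
    refine tendsto_nhds_unique this ?_
    refine tendsto_const_nhds.congr fun R => ?_
    simp
  apply Complex.ext
  · rw [Complex.ofReal_re, h3]; field_simp
  · rw [h4, Complex.ofReal_im]

noncomputable def airyAi' : ℝ → ℝ := deriv airyAi

lemma airyAi_eq {e : ℝ} (he : 0 < e) (x : ℝ) :
    airyAi x = (airyContour 0 e x).re / (2 * Real.pi) := by
  rw [airyContour_zero he, Complex.ofReal_re]; field_simp

lemma hasDerivAt_re {f : ℝ → ℂ} {f' : ℂ} {x : ℝ} (h : HasDerivAt f f' x) :
    HasDerivAt (fun x => (f x).re) f'.re x :=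
  Complex.reCLM.hasFDerivAt.comp_hasDerivAt x h

lemma hasDerivAt_airyAi_contour {e : ℝ} (he : 0 < e) (x : ℝ) :
    HasDerivAt airyAi ((airyContour 1 e x).re / (2 * Real.pi)) x := by
  have h : airyAi = fun x => (airyContour 0 e x).re / (2 * Real.pi) := funext (airyAi_eq he)
  rw [h]
  exact (hasDerivAt_re (hasDerivAt_airyContour 0 he x)).div_const _

lemma airyAi'_eq {e : ℝ} (he : 0 < e) (x : ℝ) :
    airyAi' x = (airyContour 1 e x).re / (2 * Real.pi) :=
  (hasDerivAt_airyAi_contour he x).deriv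

lemma hasDerivAt_airyAi (x : ℝ) : HasDerivAt airyAi (airyAi' x) x := by
  rw [airyAi'_eq one_pos]; exact hasDerivAt_airyAi_contour one_pos x

/-- The Airy equation. -/
lemma hasDerivAt_airyAi' (x : ℝ) : HasDerivAt airyAi' (x * airyAi x) x := by
  have h : airyAi' = fun x => (airyContour 1 1 x).re / (2 * Real.pi) :=
    funext (airyAi'_eq one_pos)
  rw [h, airyAi_eq one_pos]
  refine ((hasDerivAt_re (hasDerivAt_airyContour 1 one_pos x)).div_const _).congr_deriv ?_
  rw [airyContour_two one_pos, Complex.re_ofReal_mul]; ring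

/-- The height of the contour is free; height `b` yields decay rate `b`. -/
lemma exists_airyAi_bound {b : ℝ} (hb : 0 < b) :
    ∃ C, 0 ≤ C ∧ ∀ x, |airyAi x| ≤ C * Real.exp (-(b * x)) := by
  obtain ⟨C, hC0, hC⟩ := exists_airyContour_bound 0 hb
  refine ⟨C / (2 * Real.pi), by positivity, fun x => ?_⟩
  rw [airyAi_eq hb, abs_div, abs_of_pos Real.two_pi_pos, div_mul_eq_mul_div]
  gcongr
  exact (Complex.abs_re_le_norm _).trans (hC x)

lemma exists_airyAi'_bound {b : ℝ} (hb : 0 < b) :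
    ∃ C, 0 ≤ C ∧ ∀ x, |airyAi' x| ≤ C * Real.exp (-(b * x)) := by
  obtain ⟨C, hC0, hC⟩ := exists_airyContour_bound 1 hb
  refine ⟨C / (2 * Real.pi), by positivity, fun x => ?_⟩
  rw [airyAi'_eq hb, abs_div, abs_of_pos Real.two_pi_pos, div_mul_eq_mul_div]
  gcongr
  exact (Complex.abs_re_le_norm _).trans (hC x)

@[fun_prop]
lemma continuous_airyAi : Continuous airyAi :=
  continuous_iff_continuousAt.2 fun x => (hasDerivAt_airyAi x).continuousAt

@[fun_prop]
lemma continuous_airyAi' : Continuous airyAi' :=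
  continuous_iff_continuousAt.2 fun x => (hasDerivAt_airyAi' x).continuousAt

/-- Up to a nonzero factor, `Ai (-2πw)` is the Fourier transform at `w` of the phase on the line of
height `1`. If `Ai` were zero, Fourier inversion would make an exponential vanish. -/
lemma exists_airyAi_ne_zero : ∃ x, airyAi x ≠ 0 := by
  by_contra! h
  set G : ℝ → ℂ := fun t => airyPhase 0 (airyLine 1 t) with hG
  have hGc : Continuous G := by fun_prop
  have hGi : Integrable G := by simpa using integrable_airyIntegrand 0 one_pos 0
  have hF : FourierTransform.fourier G = 0 := by
    ext w
    rw [Real.fourier_real_eq_integral_exp_smul]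
    have h1 := airyContour_zero one_pos (-2 * Real.pi * w)
    rw [h] at h1
    have h2 : ∀ t : ℝ, Complex.exp (((-2 * Real.pi * t * w : ℝ) : ℂ) * Complex.I) • G t
        = Complex.exp ((-2 * Real.pi * w : ℝ) : ℂ) * ((Complex.I * airyLine 1 t) ^ 0 *
          airyPhase (-2 * Real.pi * w) (airyLine 1 t)) := by
      intro t
      simp only [hG, airyPhase, smul_eq_mul, pow_zero, one_mul, ← Complex.exp_add]
      congr 1
      simp only [airyLine]
      push_cast
      linear_combination (2 * Real.pi * w : ℂ) * Complex.I_sq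
    simp_rw [h2]
    rw [integral_const_mul]
    change _ * airyContour 0 1 _ = _
    rw [h1]; simp
  have h0 := congrFun (hGc.fourierInv_fourier_eq hGi (by rw [hF]; exact integrable_zero _ _ _)) 0
  rw [hF] at h0
  have h1 : FourierTransformInv.fourierInv (0 : ℝ → ℂ) 0 = 0 := by
    rw [Real.fourierInv_eq]; simp
  rw [h1] at h0
  exact Complex.exp_ne_zero _ h0.symm

/-- Uniqueness for the linear system `(u, v)' = (v, t u)`: a common zero would make `Ai` identically
zero. -/
lemma airyAi_ne_zero_or (x : ℝ) : airyAi x ≠ 0 ∨ airyAi' x ≠ 0 := by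
  by_contra! h
  obtain ⟨y, hy⟩ := exists_airyAi_ne_zero
  set M : ℝ := |x| + |y| + 1 with hM
  have hM0 : 0 < M := by positivity
  have hx : |x| < M := by rw [hM]; linarith [abs_nonneg y]
  have hyM : |y| < M := by rw [hM]; linarith [abs_nonneg x]
  have := ODE_solution_unique_of_mem_Icc (v := fun t (p : ℝ × ℝ) => (p.2, t * p.1))
    (s := fun _ => univ) (K := ⟨M + 1, by positivity⟩)
    (f := fun t => (airyAi t, airyAi' t)) (g := fun _ => ((0 : ℝ), (0 : ℝ)))
    (a := -M) (b := M) (t₀ := x) ?_ (abs_lt.1 hx) ?_ ?_ ?_ ?_ ?_ ?_ ?_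
  · have h1 := this (x := y) ⟨(abs_lt.1 hyM).1.le, (abs_lt.1 hyM).2.le⟩
    exact hy (congrArg Prod.fst h1)
  · intro t ht
    apply LipschitzOnWith.of_dist_le_mul
    intro p _ q _
    simp only [Prod.dist_eq, Real.dist_eq, ← mul_sub, abs_mul]
    have ht' : |t| ≤ M := abs_le.2 ⟨ht.1.le, ht.2.le⟩
    change _ ≤ (M + 1) * _
    apply max_le
    · have := le_max_right |p.1 - q.1| |p.2 - q.2|
      nlinarith [abs_nonneg (p.2 - q.2)]
    · have := le_max_left |p.1 - q.1| |p.2 - q.2|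
      calc |t| * |p.1 - q.1| ≤ (M + 1) * |p.1 - q.1| := by gcongr; linarith
        _ ≤ _ := by gcongr
  · fun_prop
  · exact fun t _ => (hasDerivAt_airyAi t).prodMk (hasDerivAt_airyAi' t)
  · exact fun t _ => mem_univ _
  · fun_prop
  · exact fun t _ => (hasDerivAt_const t _).congr_deriv (by ext <;> simp)
  · exact fun t _ => mem_univ _
  · simp [h.1, h.2]

/-! ### Hankel-type operators with rapidly decaying kernels -/

/-- Continuous functions that decay faster than every exponential at `+∞`. -/
structure RapidDecay (k : ℝ → ℝ) : Prop where
  continuous : Continuous k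
  isBigO : ∀ b : ℝ, 0 < b → k =O[atTop] fun x => Real.exp (-b * x)

/-- Functions on the half-line that are integrable against every decaying exponential. -/
def SubExp (f : ℝ → ℝ) : Prop :=
  ∀ b : ℝ, 0 < b → IntegrableOn (fun y => Real.exp (-b * y) * f y) (Ioi 0)

noncomputable def halfLineOp (k f : ℝ → ℝ) (x : ℝ) : ℝ :=
  ∫ y in Ioi (0 : ℝ), k (x + y) * f y

namespace RapidDecay

variable {k l : ℝ → ℝ}

lemma of_bound (hc : Continuous k)
    (h : ∀ b : ℝ, 0 < b → ∃ C, 0 ≤ C ∧ ∀ x, 0 ≤ x → |k x| ≤ C * Real.exp (-(b * x))) :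
    RapidDecay k := by
  refine ⟨hc, fun b hb => ?_⟩
  obtain ⟨C, -, hC⟩ := h b hb
  refine Asymptotics.IsBigO.of_bound C ((eventually_ge_atTop 0).mono fun x hx => ?_)
  simpa [abs_of_pos (Real.exp_pos _)] using hC x hx

lemma exists_bound (hk : RapidDecay k) {b : ℝ} (hb : 0 < b) (a : ℝ) :
    ∃ C, 0 ≤ C ∧ ∀ x, a ≤ x → |k x| ≤ C * Real.exp (-b * x) := by
  obtain ⟨C, hC⟩ := (hk.isBigO b hb).bound
  obtain ⟨A, hA⟩ := eventually_atTop.1 hC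
  obtain ⟨D, hD⟩ := (isCompact_Icc (a := a) (b := A)).exists_bound_of_continuousOn
    (f := fun x => k x * Real.exp (b * x)) (by have := hk.continuous; fun_prop)
  refine ⟨max (max C D) 0, le_max_right _ _, fun x hx => ?_⟩
  rcases le_total A x with h | h
  · have := hA x h
    rw [Real.norm_eq_abs, Real.norm_eq_abs, abs_of_pos (Real.exp_pos _)] at this
    refine this.trans ?_
    gcongr
    exact (le_max_left _ _).trans (le_max_left _ _)
  · have := hD x ⟨hx, h⟩
    rw [Real.norm_eq_abs, abs_mul, abs_of_pos (Real.exp_pos _)] at this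
    have h2 : |k x| = |k x| * Real.exp (b * x) * Real.exp (-b * x) := by
      rw [mul_assoc, ← Real.exp_add]; simp
    rw [h2]
    gcongr
    exact this.trans ((le_max_right _ _).trans (le_max_left _ _))

lemma add (hk : RapidDecay k) (hl : RapidDecay l) : RapidDecay (fun x => k x + l x) :=
  ⟨hk.continuous.add hl.continuous, fun b hb => (hk.isBigO b hb).add (hl.isBigO b hb)⟩

lemma const_mul (hk : RapidDecay k) (a : ℝ) : RapidDecay (fun x => a * k x) :=
  ⟨hk.continuous.const_mul a, fun b hb => (hk.isBigO b hb).const_mul_left a⟩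

lemma neg (hk : RapidDecay k) : RapidDecay (fun x => -k x) := by
  simpa using hk.const_mul (-1)

lemma sub (hk : RapidDecay k) (hl : RapidDecay l) : RapidDecay (fun x => k x - l x) := by
  simpa [sub_eq_add_neg] using hk.add hl.neg

lemma mul (hk : RapidDecay k) (hl : RapidDecay l) : RapidDecay (fun x => k x * l x) := by
  refine ⟨hk.continuous.mul hl.continuous, fun b hb => ?_⟩
  refine ((hk.isBigO (b / 2) (half_pos hb)).mul (hl.isBigO (b / 2) (half_pos hb))).congr_right
    fun x => ?_
  rw [← Real.exp_add]; ring_nf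

lemma id_mul (hk : RapidDecay k) : RapidDecay (fun x => x * k x) := by
  refine ⟨continuous_id.mul hk.continuous, fun b hb => ?_⟩
  have h1 : (fun x : ℝ => x) =O[atTop] fun x => Real.exp (1 * x) := by
    have := (isLittleO_pow_exp_pos_mul_atTop (k := 1) one_pos).isBigO
    simpa using this
  refine (h1.mul (hk.isBigO (b + 1) (by linarith))).congr_right fun x => ?_
  rw [← Real.exp_add]; ring_nf

lemma comp_add (hk : RapidDecay k) (a : ℝ) : RapidDecay (fun x => k (x + a)) := by
  refine ⟨hk.continuous.comp (continuous_add_const a), fun b hb => ?_⟩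
  have := (hk.isBigO b hb).comp_tendsto (tendsto_atTop_add_const_right atTop a tendsto_id)
  refine this.trans (Asymptotics.IsBigO.of_bound (Real.exp (-b * a)) ?_)
  refine Eventually.of_forall fun x => ?_
  simp only [Function.comp, id, Real.norm_eq_abs, abs_of_pos (Real.exp_pos _), ← Real.exp_add]
  apply le_of_eq; ring_nf

lemma tendsto_zero (hk : RapidDecay k) : Tendsto k atTop (𝓝 0) := by
  refine (hk.isBigO 1 one_pos).trans_tendsto ?_
  simpa using Real.tendsto_exp_neg_atTop_nhds_zero

lemma integrableOn (hk : RapidDecay k) : IntegrableOn k (Ioi 0) :=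
  integrable_of_isBigO_exp_neg one_pos hk.continuous.continuousOn (hk.isBigO 1 one_pos)

lemma subExp (hk : RapidDecay k) : SubExp k := by
  intro b hb
  refine integrable_of_isBigO_exp_neg hb (by have := hk.continuous; fun_prop) ?_
  have h1 : (fun x : ℝ => Real.exp (-b * x)) =O[atTop] fun x => Real.exp (-b * x) :=
    Asymptotics.isBigO_refl _ _
  refine (h1.mul (hk.isBigO b hb)).trans (Asymptotics.IsBigO.of_bound 1 ?_)
  filter_upwards [eventually_ge_atTop 0] with x hx
  rw [← Real.exp_add, Real.norm_eq_abs, Real.norm_eq_abs, Real.abs_exp, Real.abs_exp, one_mul]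
  apply Real.exp_le_exp.2
  nlinarith

end RapidDecay

namespace SubExp

variable {f : ℝ → ℝ}

lemma id_mul (hf : SubExp f) : SubExp (fun y => y * f y) := by
  intro b hb
  have h := (hf (b / 2) (half_pos hb)).bdd_mul (f := fun y : ℝ => y * Real.exp (-(b / 2) * y))
    (c := 2 / b) (Continuous.aestronglyMeasurable (by fun_prop)) ?_
  · refine h.congr (Eventually.of_forall fun y => ?_)
    have : Real.exp (-b * y) = Real.exp (-(b / 2) * y) * Real.exp (-(b / 2) * y) := by
      rw [← Real.exp_add]; ring_nf
    simp only [this]; ring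
  · refine (ae_restrict_mem measurableSet_Ioi).mono fun y hy => ?_
    have hy0 : 0 < y := hy
    rw [Real.norm_eq_abs, abs_of_pos (mul_pos hy0 (Real.exp_pos _)), neg_mul, Real.exp_neg,
      ← div_eq_mul_inv, div_le_div_iff₀ (Real.exp_pos _) hb]
    have := Real.add_one_le_exp (b / 2 * y)
    nlinarith

lemma of_memLp (hf : MemLp f 2 (volume.restrict (Ioi 0))) : SubExp f := by
  intro b hb
  have h : MemLp (fun y => Real.exp (-b * y)) 2 (volume.restrict (Ioi (0 : ℝ))) := by
    rw [memLp_two_iff_integrable_sq (Continuous.aestronglyMeasurable (by fun_prop))]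
    have := exp_neg_integrableOn_Ioi 0 (b := 2 * b) (by linarith)
    refine this.congr (Eventually.of_forall fun y => ?_)
    simp only [← Real.exp_nat_mul]; push_cast; ring_nf
  exact h.integrable_mul hf

lemma integrableOn_kernel_mul {k : ℝ → ℝ} (hk : RapidDecay k) (hf : SubExp f) (x : ℝ) :
    IntegrableOn (fun y => k (x + y) * f y) (Ioi 0) := by
  obtain ⟨C, hC0, hC⟩ := hk.exists_bound one_pos x
  have hc := hk.continuous
  have h := (hf 1 one_pos).bdd_mul (f := fun y : ℝ => k (x + y) * Real.exp (1 * y))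
    (c := C * Real.exp (-x)) (Continuous.aestronglyMeasurable (by fun_prop)) ?_
  · refine h.congr (Eventually.of_forall fun y => ?_)
    have : Real.exp (1 * y) * Real.exp (-1 * y) = 1 := by rw [← Real.exp_add]; simp
    simp only
    linear_combination k (x + y) * f y * this
  · refine (ae_restrict_mem measurableSet_Ioi).mono fun y hy => ?_
    have hy0 : 0 < y := hy
    rw [Real.norm_eq_abs, abs_mul, Real.abs_exp]
    calc _ ≤ C * Real.exp (-1 * (x + y)) * Real.exp (1 * y) := by
          gcongr; exact hC _ (by linarith)
      _ = _ := by rw [mul_assoc, ← Real.exp_add]; ring_nf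

end SubExp

/-- The norm of `f` in `L¹` with weight `exp (-y)`. -/
noncomputable def expNorm (f : ℝ → ℝ) : ℝ := ∫ y in Ioi (0 : ℝ), Real.exp (-1 * y) * |f y|

lemma expNorm_nonneg (f : ℝ → ℝ) : 0 ≤ expNorm f :=
  integral_nonneg fun _ => mul_nonneg (Real.exp_pos _).le (abs_nonneg _)

lemma abs_halfLineOp_le {k f : ℝ → ℝ} (hf : SubExp f) {C b : ℝ} (hb : 0 < b)
    (hC : ∀ x, 0 ≤ x → |k x| ≤ C * Real.exp (-b * x)) {x : ℝ} (hx : 0 ≤ x) :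
    |halfLineOp k f x| ≤
      C * Real.exp (-b * x) * ∫ y in Ioi (0 : ℝ), Real.exp (-b * y) * |f y| := by
  rw [← integral_const_mul]
  have hi : IntegrableOn (fun y => C * Real.exp (-b * x) * (Real.exp (-b * y) * |f y|)) (Ioi 0) := by
    refine ((hf b hb).norm.const_mul (C * Real.exp (-b * x))).congr
      (Eventually.of_forall fun y => ?_)
    simp
  refine norm_integral_le_of_norm_le (f := fun y => k (x + y) * f y) hi ((ae_restrict_mem measurableSet_Ioi).mono fun y hy => ?_)
  have hy0 : 0 < y := hy
  rw [Real.norm_eq_abs, abs_mul]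
  calc _ ≤ C * Real.exp (-b * (x + y)) * |f y| := by gcongr; exact hC _ (by linarith)
    _ = _ := by rw [mul_add, Real.exp_add]; ring

lemma hasDerivAt_halfLineOp {k k' f : ℝ → ℝ} (hk : RapidDecay k) (hk' : RapidDecay k')
    (hd : ∀ x, HasDerivAt k (k' x) x) (hf : SubExp f) (x : ℝ) :
    HasDerivAt (halfLineOp k f) (halfLineOp k' f x) x := by
  obtain ⟨C, hC0, hC⟩ := hk'.exists_bound one_pos (x - 1)
  refine (hasDerivAt_integral_of_dominated_loc_of_deriv_le (𝕜 := ℝ)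
    (μ := volume.restrict (Ioi (0 : ℝ)))
    (F := fun x y => k (x + y) * f y) (F' := fun x y => k' (x + y) * f y)
    (bound := fun y => C * Real.exp (-(x - 1)) * ‖Real.exp (-1 * y) * f y‖)
    (Ioi_mem_nhds (show x - 1 < x by linarith)) ?_ (hf.integrableOn_kernel_mul hk x) ?_ ?_ ?_
    ?_).2
  · exact Eventually.of_forall fun z => (hf.integrableOn_kernel_mul hk z).aestronglyMeasurable
  · exact (hf.integrableOn_kernel_mul hk' x).aestronglyMeasurable
  · refine (ae_restrict_mem measurableSet_Ioi).mono fun y hy z hz => ?_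
    have hy0 : 0 < y := hy
    have hz0 : x - 1 < z := hz
    rw [norm_mul, norm_mul, Real.norm_eq_abs, Real.norm_eq_abs (Real.exp _), Real.abs_exp]
    calc _ ≤ C * Real.exp (-1 * (z + y)) * ‖f y‖ := by gcongr; exact hC _ (by linarith)
      _ ≤ C * Real.exp (-(x - 1) + -1 * y) * ‖f y‖ := by gcongr ?_ * Real.exp ?_ * ?_; linarith
      _ = _ := by rw [Real.exp_add]; ring
  · exact (hf 1 one_pos).norm.const_mul _
  · refine Eventually.of_forall fun y z _ => ?_
    exact ((hd (z + y)).comp_add_const z y).mul_const _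

lemma RapidDecay.halfLineOp {k f : ℝ → ℝ} (hk : RapidDecay k) (hf : SubExp f)
    (hc : Continuous (halfLineOp k f)) : RapidDecay (halfLineOp k f) := by
  refine .of_bound hc fun b hb => ?_
  obtain ⟨C, hC0, hC⟩ := hk.exists_bound hb 0
  refine ⟨C * ∫ y in Ioi (0 : ℝ), Real.exp (-b * y) * |f y|,
    mul_nonneg hC0 (integral_nonneg fun _ => mul_nonneg (Real.exp_pos _).le (abs_nonneg _)),
    fun x hx => (abs_halfLineOp_le hf hb hC hx).trans (le_of_eq ?_)⟩
  rw [neg_mul]; ring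

/-- Fubini: the kernel depends on `x + y` only, so it is symmetric. -/
lemma integral_halfLineOp_mul {k f g : ℝ → ℝ} (hk : RapidDecay k) (hf : SubExp f)
    (hg : SubExp g) :
    ∫ x in Ioi (0 : ℝ), halfLineOp k f x * g x = ∫ x in Ioi (0 : ℝ), f x * halfLineOp k g x := by
  simp only [halfLineOp, ← integral_mul_const, ← integral_const_mul]
  rw [integral_integral_swap]
  · refine integral_congr_ae (Eventually.of_forall fun x => ?_)
    refine integral_congr_ae (Eventually.of_forall fun y => ?_)
    simp only [add_comm y x]; ring
  · obtain ⟨C, hC0, hC⟩ := hk.exists_bound one_pos 0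
    have hc := hk.continuous
    have h := ((hg 1 one_pos).mul_prod (hf 1 one_pos)).bdd_mul
      (f := fun p : ℝ × ℝ => k (p.1 + p.2) * Real.exp (p.1 + p.2))
      (c := C) (Continuous.aestronglyMeasurable (by fun_prop)) ?_
    · refine h.congr (Eventually.of_forall fun p => ?_)
      have : Real.exp (p.1 + p.2) * Real.exp (-1 * p.1) * Real.exp (-1 * p.2) = 1 := by
        rw [← Real.exp_add, ← Real.exp_add]; ring_nf; simp
      simp only [Function.uncurry]
      linear_combination k (p.1 + p.2) * f p.2 * g p.1 * this
    · rw [Measure.prod_restrict]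
      refine (ae_restrict_mem (measurableSet_Ioi.prod measurableSet_Ioi)).mono fun p hp => ?_
      have h1 : 0 < p.1 := hp.1
      have h2 : 0 < p.2 := hp.2
      rw [norm_mul, Real.norm_eq_abs, Real.norm_eq_abs, Real.abs_exp]
      calc _ ≤ C * Real.exp (-1 * (p.1 + p.2)) * Real.exp (p.1 + p.2) := by
            gcongr; exact hC _ (by linarith)
        _ = C := by rw [mul_assoc, ← Real.exp_add]; simp

/-! ### The operators with kernels `Ai` and `Ai'` -/

/-- The kernel of `T_c` and its derivative. -/
noncomputable def airyKer (c s : ℝ) : ℝ := airyAi (s + c)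

noncomputable def airyKer' (c s : ℝ) : ℝ := airyAi' (s + c)

lemma rapidDecay_airyKer (c : ℝ) : RapidDecay (airyKer c) :=
  RapidDecay.comp_add (.of_bound continuous_airyAi fun _ hb =>
    (exists_airyAi_bound hb).imp fun _ h => ⟨h.1, fun x _ => h.2 x⟩) c

lemma rapidDecay_airyKer' (c : ℝ) : RapidDecay (airyKer' c) :=
  RapidDecay.comp_add (.of_bound continuous_airyAi' fun _ hb =>
    (exists_airyAi'_bound hb).imp fun _ h => ⟨h.1, fun x _ => h.2 x⟩) c

lemma hasDerivAt_airyKer (c s : ℝ) : HasDerivAt (airyKer c) (airyKer' c s) s :=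
  (hasDerivAt_airyAi (s + c)).comp_add_const s c

lemma hasDerivAt_airyKer' (c s : ℝ) : HasDerivAt (airyKer' c) ((s + c) * airyKer c s) s :=
  (hasDerivAt_airyAi' (s + c)).comp_add_const s c

section

variable {c : ℝ} {f : ℝ → ℝ}

lemma hasDerivAt_airyOp (hf : SubExp f) (x : ℝ) :
    HasDerivAt (halfLineOp (airyKer c) f) (halfLineOp (airyKer' c) f x) x :=
  hasDerivAt_halfLineOp (rapidDecay_airyKer c) (rapidDecay_airyKer' c) (hasDerivAt_airyKer c) hf x

/-- The factor `x + y + c` from the Airy equation splits: `x + c` leaves the integral and `y` passes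
to `f`. -/
lemma hasDerivAt_airyOp' (hf : SubExp f) (x : ℝ) :
    HasDerivAt (halfLineOp (airyKer' c) f)
      ((x + c) * halfLineOp (airyKer c) f x + halfLineOp (airyKer c) (fun y => y * f y) x) x := by
  have hr : RapidDecay fun s => (s + c) * airyKer c s := by
    simpa only [add_mul] using
      (rapidDecay_airyKer c).id_mul.add ((rapidDecay_airyKer c).const_mul c)
  refine (hasDerivAt_halfLineOp (rapidDecay_airyKer' c) hr (hasDerivAt_airyKer' c) hf x).congr_deriv
    ?_
  rw [halfLineOp, halfLineOp, halfLineOp, ← integral_const_mul, ← integral_add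
    ((hf.integrableOn_kernel_mul (rapidDecay_airyKer c) x).const_mul _)
    (hf.id_mul.integrableOn_kernel_mul (rapidDecay_airyKer c) x)]
  congr 1; ext y; ring

lemma rapidDecay_airyOp (hf : SubExp f) : RapidDecay (halfLineOp (airyKer c) f) :=
  (rapidDecay_airyKer c).halfLineOp hf
    (continuous_iff_continuousAt.2 fun x => (hasDerivAt_airyOp hf x).continuousAt)

lemma rapidDecay_airyOp' (hf : SubExp f) : RapidDecay (halfLineOp (airyKer' c) f) :=
  (rapidDecay_airyKer' c).halfLineOp hf
    (continuous_iff_continuousAt.2 fun x => (hasDerivAt_airyOp' hf x).continuousAt)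

/-- The induction treats all `f` and both kernels at once, because the derivative of each operator
involves the other kernel or the function `y f`. -/
lemma contDiff_airyOp_aux (n : ℕ) : ∀ {f : ℝ → ℝ}, SubExp f →
    ContDiff ℝ n (halfLineOp (airyKer c) f) ∧ ContDiff ℝ n (halfLineOp (airyKer' c) f) := by
  induction n with
  | zero =>
    intro f hf
    exact ⟨contDiff_zero.2 (rapidDecay_airyOp hf).continuous,
      contDiff_zero.2 (rapidDecay_airyOp' hf).continuous⟩
  | succ n ih =>
    intro f hf
    have hd := fun x => hasDerivAt_airyOp (c := c) hf x
    have hd' := fun x => hasDerivAt_airyOp' (c := c) hf x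
    push_cast
    rw [contDiff_succ_iff_deriv, contDiff_succ_iff_deriv, funext fun x => (hd x).deriv,
      funext fun x => (hd' x).deriv]
    refine ⟨⟨fun x => (hd x).differentiableAt, by simp, (ih hf).2⟩,
      fun x => (hd' x).differentiableAt, by simp, ?_⟩
    exact ((contDiff_id.add contDiff_const).mul (ih hf).1).add (ih hf.id_mul).1

lemma contDiff_airyOp (hf : SubExp f) : ContDiff ℝ ∞ (halfLineOp (airyKer c) f) :=
  contDiff_infty.2 fun n => (contDiff_airyOp_aux n hf).1

end

/-! ### Determinacy of moments and injectivity of `T_c` -/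

/-- The exponential series may be integrated term by term, its partial sums being dominated by `exp
(|t| |y|) |g y|`. -/
lemma integral_cexp_mul_eq_zero_of_moments {μ : Measure ℝ} {g : ℝ → ℝ}
    (hg : ∀ b : ℝ, Integrable (fun y => Real.exp (b * |y|) * g y) μ)
    (hm : ∀ n : ℕ, ∫ y, y ^ n * g y ∂μ = 0) (t : ℝ) :
    ∫ y, Complex.exp (t * y * Complex.I) * g y ∂μ = 0 := by
  have hgm : AEStronglyMeasurable g μ := by simpa using (hg 0).aestronglyMeasurable
  have hgm' : AEStronglyMeasurable (fun y => (g y : ℂ)) μ :=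
    Complex.continuous_ofReal.comp_aestronglyMeasurable hgm
  have hb : ∀ y : ℝ, HasSum (fun n : ℕ => (|t| * |y|) ^ n / n.factorial * |g y|)
      (Real.exp (|t| * |y|) * |g y|) := fun y => by
    have := (NormedSpace.expSeries_div_hasSum_exp (𝔸 := ℝ) (|t| * |y|)).mul_right |g y|
    rwa [← Real.exp_eq_exp_ℝ] at this
  have key := hasSum_integral_of_dominated_convergence (μ := μ)
    (F := fun (n : ℕ) (y : ℝ) => (t * y * Complex.I) ^ n / n.factorial * (g y : ℂ))
    (f := fun y => Complex.exp (t * y * Complex.I) * g y)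
    (fun n y => (|t| * |y|) ^ n / n.factorial * |g y|) ?_ ?_ ?_ ?_ ?_
  · refine (key.unique ?_)
    convert hasSum_zero with n
    have : ∀ y : ℝ, (t * y * Complex.I) ^ n / n.factorial * (g y : ℂ)
        = ((t * Complex.I) ^ n / n.factorial) * ((y ^ n * g y : ℝ) : ℂ) := fun y => by
      push_cast; ring
    simp_rw [this]
    rw [integral_const_mul, integral_complex_ofReal, hm]; simp
  · intro n
    exact (Continuous.aestronglyMeasurable (by fun_prop)).mul hgm'
  · intro n
    refine Eventually.of_forall fun y => le_of_eq ?_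
    simp
  · exact Eventually.of_forall fun y => (hb y).summable
  · simp_rw [fun y => (hb y).tsum_eq]
    refine (hg |t|).norm.congr (Eventually.of_forall fun y => ?_)
    simp
  · refine Eventually.of_forall fun y => ?_
    have := (NormedSpace.expSeries_div_hasSum_exp (𝔸 := ℂ) (t * y * Complex.I)).mul_right (g y : ℂ)
    rwa [← Complex.exp_eq_exp_ℂ] at this

/-- A function with exponential moments of all orders is determined by its moments. -/
lemma ae_eq_zero_of_moments {μ : Measure ℝ} {g : ℝ → ℝ}
    (hg : ∀ b : ℝ, Integrable (fun y => Real.exp (b * |y|) * g y) μ)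
    (hm : ∀ n : ℕ, ∫ y, y ^ n * g y ∂μ = 0) : g =ᵐ[μ] 0 := by
  have hgi : Integrable g μ := by simpa using hg 0
  have hfin : ∀ {h : ℝ → ℝ}, Integrable h μ →
      ∫⁻ y, ENNReal.ofReal (h y) ∂μ ≠ ⊤ := fun {h} hh =>
    ((lintegral_mono fun y => Real.ofReal_le_enorm (h y)).trans_lt hh.2).ne
  have : IsFiniteMeasure (μ.withDensity fun y => ENNReal.ofReal (g y)) :=
    isFiniteMeasure_withDensity (hfin hgi)
  have : IsFiniteMeasure (μ.withDensity fun y => ENNReal.ofReal (-g y)) :=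
    isFiniteMeasure_withDensity (hfin hgi.neg)
  have hm1 : AEMeasurable (fun y => ENNReal.ofReal (g y)) μ :=
    hgi.aestronglyMeasurable.aemeasurable.ennreal_ofReal
  have hm2 : AEMeasurable (fun y => ENNReal.ofReal (-g y)) μ :=
    hgi.neg.aestronglyMeasurable.aemeasurable.ennreal_ofReal
  -- The positive and negative parts of `g` are densities of finite measures; their characteristic
  -- functions differ by `∫ exp (i t y) g`, which is zero.
  have heq : (μ.withDensity fun y => ENNReal.ofReal (g y))
      = μ.withDensity fun y => ENNReal.ofReal (-g y) := by
    apply Measure.ext_of_charFun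
    ext t
    rw [charFun_apply_real, charFun_apply_real,
      integral_withDensity_eq_integral_toReal_smul₀ hm1
        (Eventually.of_forall fun _ => ENNReal.ofReal_lt_top),
      integral_withDensity_eq_integral_toReal_smul₀ hm2
        (Eventually.of_forall fun _ => ENNReal.ofReal_lt_top), ← sub_eq_zero]
    have hint : ∀ {h : ℝ → ℝ}, Integrable h μ → Integrable (fun y : ℝ =>
        (ENNReal.ofReal (h y)).toReal • Complex.exp (t * y * Complex.I)) μ := fun {h} hh => by
      have h1 : Integrable (fun y => (((ENNReal.ofReal (h y)).toReal : ℝ) : ℂ)) μ := by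
        simp only [ENNReal.toReal_ofReal']
        exact hh.pos_part.ofReal
      refine (h1.bdd_mul (c := 1) (f := fun y : ℝ => Complex.exp (t * y * Complex.I))
        (Continuous.aestronglyMeasurable (by fun_prop))
        (Eventually.of_forall fun y => ?_)).congr (Eventually.of_forall fun y => ?_)
      · rw [← Complex.ofReal_mul, Complex.norm_exp_ofReal_mul_I]
      · simp only [Complex.real_smul]; ring
    have hn : Integrable (fun y => -g y) μ := hgi.neg
    rw [← integral_sub (hint hgi) (hint hn), ← integral_cexp_mul_eq_zero_of_moments hg hm t]
    refine integral_congr_ae (Eventually.of_forall fun y => ?_)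
    simp only [ENNReal.toReal_ofReal', Complex.real_smul]
    rw [← sub_mul, mul_comm, ← Complex.ofReal_sub]
    congr 2
    rcases le_total 0 (g y) with h | h <;> simp [h]
  rw [withDensity_eq_iff hm1 hm2 (hfin hgi)] at heq
  filter_upwards [heq] with y hy
  rcases lt_trichotomy (g y) 0 with h | h | h
  · rw [ENNReal.ofReal_of_nonpos h.le] at hy
    have := ENNReal.ofReal_eq_zero.1 hy.symm
    simp; linarith
  · exact h
  · rw [ENNReal.ofReal_of_nonpos (p := -g y) (by linarith)] at hy
    have := ENNReal.ofReal_eq_zero.1 hy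
    simp; linarith

lemma RapidDecay.exp_mul {k : ℝ → ℝ} (hk : RapidDecay k) (a : ℝ) :
    RapidDecay (fun x => Real.exp (a * x) * k x) := by
  refine ⟨by have := hk.continuous; fun_prop, fun b hb => ?_⟩
  refine ((Asymptotics.isBigO_refl (fun x : ℝ => Real.exp (a * x)) atTop).mul
    (hk.isBigO (b + |a|) (by positivity))).trans (Asymptotics.IsBigO.of_bound 1 ?_)
  filter_upwards [eventually_ge_atTop 0] with x hx
  rw [← Real.exp_add, Real.norm_eq_abs, Real.norm_eq_abs, Real.abs_exp, Real.abs_exp, one_mul]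
  apply Real.exp_le_exp.2
  nlinarith [le_abs_self a]

lemma kernel_mul_ae_eq_zero {k f : ℝ → ℝ} (hk : RapidDecay k) (hf : SubExp f)
    (h : ∀ n : ℕ, halfLineOp k (fun y => y ^ n * f y) 0 = 0) :
    (fun y => k y * f y) =ᵐ[volume.restrict (Ioi 0)] 0 := by
  refine ae_eq_zero_of_moments (fun b => ?_) fun n => ?_
  · refine (hf.integrableOn_kernel_mul (hk.exp_mul b) 0).congr
      ((ae_restrict_mem measurableSet_Ioi).mono fun y hy => ?_)
    have hy0 : 0 < y := hy
    simp only [zero_add, abs_of_pos hy0]; ring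
  · refine Eq.trans ?_ (h n)
    refine integral_congr_ae (Eventually.of_forall fun y => ?_)
    simp only [zero_add]; ring

/-- The right derivative determines `F'`, so the endpoint `x = a` is allowed. -/
lemma HasDerivAt.eq_zero_of_eqOn_Ici {F : ℝ → ℝ} {F' a x : ℝ} (h : HasDerivAt F F' x)
    (hF : ∀ y, a ≤ y → F y = 0) (hx : a ≤ x) : F' = 0 := by
  have h0 : HasDerivWithinAt F 0 (Ici x) x :=
    (hasDerivWithinAt_const x (Ici x) (0 : ℝ)).congr (fun y hy => hF y (hx.trans hy)) (hF x hx)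
  exact (uniqueDiffWithinAt_Ici x).eq_deriv _ h.hasDerivWithinAt h0

/-- `T_c` is injective. -/
lemma ae_eq_zero_of_airyOp_eq_zero {c : ℝ} {f : ℝ → ℝ} (hf : SubExp f)
    (h : ∀ x, 0 ≤ x → halfLineOp (airyKer c) f x = 0) :
    f =ᵐ[volume.restrict (Ioi 0)] 0 := by
  -- Differentiating `T_c h = 0` twice leaves `T_c (y h) = 0`, so any power of `y` may be inserted.
  -- At `x = 0` this gives the moments of `Ai(y + c) f`; the first derivatives give those of `Ai'(y
  -- + c) f`.
  have hpow : ∀ n : ℕ, SubExp (fun y => y ^ n * f y) ∧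
      ∀ x, 0 ≤ x → halfLineOp (airyKer c) (fun y => y ^ n * f y) x = 0 := by
    intro n
    induction n with
    | zero => simpa using ⟨hf, h⟩
    | succ n ih =>
      have h1 : ∀ x, 0 ≤ x → halfLineOp (airyKer' c) (fun y => y ^ n * f y) x = 0 :=
        fun x hx => (hasDerivAt_airyOp ih.1 x).eq_zero_of_eqOn_Ici ih.2 hx
      have e : (fun y => y ^ (n + 1) * f y) = fun y => y * (y ^ n * f y) := by ext; ring
      rw [e]
      refine ⟨ih.1.id_mul, fun x hx => ?_⟩
      have := (hasDerivAt_airyOp' ih.1 x).eq_zero_of_eqOn_Ici h1 hx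
      rwa [ih.2 x hx, mul_zero, zero_add] at this
  have h0 := kernel_mul_ae_eq_zero (rapidDecay_airyKer c) hf fun n => (hpow n).2 0 le_rfl
  have h1 := kernel_mul_ae_eq_zero (rapidDecay_airyKer' c) hf fun n =>
    (hasDerivAt_airyOp (hpow n).1 0).eq_zero_of_eqOn_Ici (hpow n).2 le_rfl
  filter_upwards [h0, h1] with y hy0 hy1
  rcases airyAi_ne_zero_or (y + c) with h | h
  · exact (mul_eq_zero.1 hy0).resolve_left h
  · exact (mul_eq_zero.1 hy1).resolve_left h

/-! ### The action of `L_c` on an eigenspace of `T_c` -/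

/-- An eigenfunction of `T_c`, or zero, extended to the whole line by its eigenvalue equation. -/
structure AiryEigen (c μ : ℝ) (f : ℝ → ℝ) : Prop where
  subExp : SubExp f
  eigen : ∀ x, μ * f x = halfLineOp (airyKer c) f x

/-- The derivative of an eigenfunction of `T_c`. -/
noncomputable def eigenDeriv (c μ : ℝ) (f : ℝ → ℝ) (x : ℝ) : ℝ := μ⁻¹ * halfLineOp (airyKer' c) f x

/-- For an eigenfunction `f` of `T_c`, this is `f'' - (x + c) f`. -/
noncomputable def eigenRest (c μ : ℝ) (f : ℝ → ℝ) (x : ℝ) : ℝ :=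
  μ⁻¹ * halfLineOp (airyKer c) (fun y => y * f y) x

noncomputable def eigenRest' (c μ : ℝ) (f : ℝ → ℝ) (x : ℝ) : ℝ :=
  μ⁻¹ * halfLineOp (airyKer' c) (fun y => y * f y) x

/-- `L_c` on eigenfunctions of `T_c`. -/
noncomputable def eigenL (c μ : ℝ) (f : ℝ → ℝ) (x : ℝ) : ℝ :=
  -eigenDeriv c μ f x - x * eigenRest c μ f x

namespace AiryEigen

variable {c μ : ℝ} {f g : ℝ → ℝ}

lemma hasDerivAt_eigenDeriv_aux (hs : SubExp f) (x : ℝ) :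
    HasDerivAt (eigenDeriv c μ f)
      (μ⁻¹ * ((x + c) * halfLineOp (airyKer c) f x +
        halfLineOp (airyKer c) (fun y => y * f y) x)) x :=
  (hasDerivAt_airyOp' hs x).const_mul _

lemma eq_inv_mul (hf : AiryEigen c μ f) (hμ : μ ≠ 0) (x : ℝ) :
    f x = μ⁻¹ * halfLineOp (airyKer c) f x := by
  rw [← hf.eigen]; field_simp

lemma hasDerivAt (hf : AiryEigen c μ f) (hμ : μ ≠ 0) (x : ℝ) :
    HasDerivAt f (eigenDeriv c μ f x) x := by
  have h : f = fun x => μ⁻¹ * halfLineOp (airyKer c) f x := funext (hf.eq_inv_mul hμ)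
  rw [congrArg (HasDerivAt · _ x) h]
  exact (hasDerivAt_airyOp hf.subExp x).const_mul _

lemma hasDerivAt_eigenDeriv (hf : AiryEigen c μ f) (hμ : μ ≠ 0) (x : ℝ) :
    HasDerivAt (eigenDeriv c μ f) ((x + c) * f x + eigenRest c μ f x) x := by
  refine (hasDerivAt_eigenDeriv_aux hf.subExp x).congr_deriv ?_
  rw [hf.eq_inv_mul hμ x, eigenRest]; ring

lemma hasDerivAt_eigenRest (hf : AiryEigen c μ f) (x : ℝ) :
    HasDerivAt (eigenRest c μ f) (eigenRest' c μ f x) x :=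
  (hasDerivAt_airyOp hf.subExp.id_mul x).const_mul _

lemma contDiff (hf : AiryEigen c μ f) (hμ : μ ≠ 0) : ContDiff ℝ ∞ f := by
  rw [show f = fun x => μ⁻¹ * halfLineOp (airyKer c) f x from funext (hf.eq_inv_mul hμ)]
  exact contDiff_const.mul (contDiff_airyOp hf.subExp)

lemma rapidDecay (hf : AiryEigen c μ f) (hμ : μ ≠ 0) : RapidDecay f := by
  rw [show f = fun x => μ⁻¹ * halfLineOp (airyKer c) f x from funext (hf.eq_inv_mul hμ)]
  exact (rapidDecay_airyOp hf.subExp).const_mul _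

lemma rapidDecay_eigenDeriv (hf : AiryEigen c μ f) : RapidDecay (eigenDeriv c μ f) :=
  (rapidDecay_airyOp' hf.subExp).const_mul _

lemma rapidDecay_eigenRest (hf : AiryEigen c μ f) : RapidDecay (eigenRest c μ f) :=
  (rapidDecay_airyOp hf.subExp.id_mul).const_mul _

lemma rapidDecay_eigenL (hf : AiryEigen c μ f) : RapidDecay (eigenL c μ f) :=
  hf.rapidDecay_eigenDeriv.neg.sub hf.rapidDecay_eigenRest.id_mul

lemma hasDerivAt_eigenL (hf : AiryEigen c μ f) (hμ : μ ≠ 0) (x : ℝ) :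
    HasDerivAt (eigenL c μ f)
      (-((x + c) * f x) - 2 * eigenRest c μ f x - x * eigenRest' c μ f x) x :=
  ((hf.hasDerivAt_eigenDeriv hμ x).neg.sub
    ((hasDerivAt_id x).mul (hf.hasDerivAt_eigenRest x))).congr_deriv (by simp; ring)

lemma integral_deriv_eq {F F' : ℝ → ℝ} (hd : ∀ x, HasDerivAt F (F' x) x)
    (hF : Tendsto F atTop (𝓝 0)) (hF' : IntegrableOn F' (Ioi 0)) :
    ∫ x in Ioi (0 : ℝ), F' x = -F 0 := by
  rw [integral_Ioi_of_hasDerivAt_of_tendsto (hd 0).continuousAt.continuousWithinAt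
    (fun x _ => hd x) hF' hF, zero_sub]

/-- `L_c` commutes with `T_c` on eigenfunctions. -/
lemma eigenL_mem (hf : AiryEigen c μ f) (hμ : μ ≠ 0) : AiryEigen c μ (eigenL c μ f) := by
  refine ⟨hf.rapidDecay_eigenL.subExp, fun x => ?_⟩
  have hk := (rapidDecay_airyKer c).comp_add x
  have hk' := (rapidDecay_airyKer' c).comp_add x
  have hr := hf.rapidDecay hμ
  -- The function is `y (Ai' f - Ai f')`, with `Ai`, `Ai'` taken at `y + x + c`. It vanishes at `0`
  -- and at infinity, and its derivative integrates to `T_c (L_c f) - μ L_c f` at `x`.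
  have hd : ∀ y, HasDerivAt
      (fun y => -airyKer c (y + x) * (y * eigenDeriv c μ f y) + airyKer' c (y + x) * (y * f y))
      (airyKer c (y + x) * eigenL c μ f y + airyKer' c (y + x) * f y
        + x * (airyKer c (y + x) * (y * f y))) y := by
    intro y
    have h1 := (hasDerivAt_airyKer c (y + x)).comp_add_const y x
    have h2 := (hasDerivAt_airyKer' c (y + x)).comp_add_const y x
    refine ((h1.neg.mul ((hasDerivAt_id y).mul (hf.hasDerivAt_eigenDeriv hμ y))).add
      (h2.mul ((hasDerivAt_id y).mul (hf.hasDerivAt hμ y)))).congr_deriv ?_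
    simp only [eigenL, id, Pi.mul_apply, Pi.neg_apply]; ring
  have i1 := (hk.mul hf.rapidDecay_eigenL).integrableOn
  have i2 := (hk'.mul hr).integrableOn
  have i3 := ((hk.mul hr.id_mul).const_mul x).integrableOn
  have i12 := ((hk.mul hf.rapidDecay_eigenL).add (hk'.mul hr)).integrableOn
  have := integral_deriv_eq hd
    ((hk.neg.mul hf.rapidDecay_eigenDeriv.id_mul).add (hk'.mul hr.id_mul)).tendsto_zero
    (i12.add i3)
  rw [integral_add i12 i3, integral_add i1 i2, integral_const_mul] at this
  simp only [zero_mul, mul_zero, add_zero, neg_zero] at this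
  have hT : halfLineOp (airyKer c) (eigenL c μ f) x + halfLineOp (airyKer' c) f x
      + x * halfLineOp (airyKer c) (fun y => y * f y) x = 0 := by
    simpa only [halfLineOp, add_comm x] using this
  have : μ * eigenL c μ f x = -halfLineOp (airyKer' c) f x
      - x * halfLineOp (airyKer c) (fun y => y * f y) x := by
    rw [eigenL, eigenDeriv, eigenRest]; field_simp
  linarith

/-- On the eigenspace, differentiation is an integral operator with symmetric kernel, so `∫ f' g = ∫
f g'`; the two add up to the boundary term `-f(0) g(0)`. -/
lemma integral_eigenDeriv_mul (hf : AiryEigen c μ f) (hg : AiryEigen c μ g) (hμ : μ ≠ 0) :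
    ∫ x in Ioi (0 : ℝ), eigenDeriv c μ f x * g x = -(f 0 * g 0) / 2 := by
  have hsym : ∫ x in Ioi (0 : ℝ), eigenDeriv c μ f x * g x
      = ∫ x in Ioi (0 : ℝ), f x * eigenDeriv c μ g x := by
    simp only [eigenDeriv, mul_assoc, mul_left_comm _ μ⁻¹, integral_const_mul]
    rw [integral_halfLineOp_mul (rapidDecay_airyKer' c) hf.subExp hg.subExp]
  have i1 := (hf.rapidDecay_eigenDeriv.mul (hg.rapidDecay hμ)).integrableOn
  have i2 := ((hf.rapidDecay hμ).mul hg.rapidDecay_eigenDeriv).integrableOn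
  have := integral_deriv_eq (fun x => (hf.hasDerivAt hμ x).mul (hg.hasDerivAt hμ x))
    ((hf.rapidDecay hμ).mul (hg.rapidDecay hμ)).tendsto_zero (i1.add i2)
  rw [integral_add i1 i2, ← hsym] at this
  simp only [Pi.mul_apply] at this
  linarith

/-- By symmetry `T_c` passes to `g`, where it is multiplication by `μ`. -/
lemma integral_eigenRest_mul (hf : AiryEigen c μ f) (hg : AiryEigen c μ g) (hμ : μ ≠ 0) :
    ∫ x in Ioi (0 : ℝ), eigenRest c μ f x * g x = ∫ x in Ioi (0 : ℝ), x * f x * g x := by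
  simp only [eigenRest, mul_assoc, integral_const_mul]
  rw [integral_halfLineOp_mul (rapidDecay_airyKer c) hf.subExp.id_mul hg.subExp]
  simp only [← hg.eigen, mul_left_comm _ μ, integral_const_mul]
  rw [mul_inv_cancel_left₀ hμ]
  simp only [mul_assoc]

/-- The Wronskian at `0` of two eigenfunctions of `T_c` with the same eigenvalue vanishes. -/
lemma wronskian_zero (hf : AiryEigen c μ f) (hg : AiryEigen c μ g) (hμ : μ ≠ 0) :
    eigenDeriv c μ f 0 * g 0 = f 0 * eigenDeriv c μ g 0 := by
  have hLf := hf.eigenL_mem hμ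
  have hLg := hg.eigenL_mem hμ
  have h1 := hf.integral_eigenDeriv_mul hLg hμ
  have h2 := hLf.integral_eigenDeriv_mul hg hμ
  have hLd : eigenDeriv c μ (eigenL c μ f) = fun x =>
      -((x + c) * f x) - 2 * eigenRest c μ f x - x * eigenRest' c μ f x :=
    funext fun x => (hLf.hasDerivAt hμ x).unique (hf.hasDerivAt_eigenL hμ x)
  have hL0 : ∀ h : ℝ → ℝ, eigenL c μ h 0 = -eigenDeriv c μ h 0 := fun h => by simp [eigenL]
  -- The function is `x (f'' g - f' g')`, which vanishes at `0` and at infinity. The last bracket of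
  -- its derivative integrates to zero, so `∫ f' L_c g = ∫ (L_c f)' g`; by `h1` and `h2` the two
  -- sides are `f(0) g'(0) / 2` and `f'(0) g(0) / 2`.
  have hd : ∀ x, HasDerivAt (fun x => -(x * (eigenDeriv c μ g x * eigenDeriv c μ f x))
        + x * (((x * f x + c * f x) + eigenRest c μ f x) * g x))
      (eigenDeriv c μ f x * eigenL c μ g x - eigenDeriv c μ (eigenL c μ f) x * g x
        - (eigenRest c μ f x * g x - x * f x * g x)) x := by
    intro x
    have e := ((hasDerivAt_id x).mul ((hg.hasDerivAt_eigenDeriv hμ x).mul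
      (hf.hasDerivAt_eigenDeriv hμ x))).neg.add ((hasDerivAt_id x).mul
      (((((hasDerivAt_id x).mul (hf.hasDerivAt hμ x)).add ((hf.hasDerivAt hμ x).const_mul c)).add
        (hf.hasDerivAt_eigenRest x)).mul (hg.hasDerivAt hμ x)))
    refine e.congr_deriv ?_
    rw [hLd]
    simp only [eigenL, id, Pi.mul_apply, Pi.add_apply]; ring
  have rf := hf.rapidDecay hμ
  have rg := hg.rapidDecay hμ
  have i1 := (hf.rapidDecay_eigenDeriv.mul hg.rapidDecay_eigenL).integrableOn
  have i2 := (hLf.rapidDecay_eigenDeriv.mul rg).integrableOn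
  have i3 := (hf.rapidDecay_eigenRest.mul rg).integrableOn
  have i4 := (rf.id_mul.mul rg).integrableOn
  have i12 := ((hf.rapidDecay_eigenDeriv.mul hg.rapidDecay_eigenL).sub
    (hLf.rapidDecay_eigenDeriv.mul rg)).integrableOn
  have i34 := ((hf.rapidDecay_eigenRest.mul rg).sub (rf.id_mul.mul rg)).integrableOn
  have := integral_deriv_eq hd
    ((hg.rapidDecay_eigenDeriv.mul hf.rapidDecay_eigenDeriv).id_mul.neg.add
      (((rf.id_mul.add (rf.const_mul c)).add hf.rapidDecay_eigenRest).mul rg).id_mul).tendsto_zero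
    (i12.sub i34)
  rw [integral_sub i12 i34, integral_sub i1 i2, integral_sub i3 i4, h1, h2,
    hf.integral_eigenRest_mul hg hμ, hL0, hL0] at this
  simp only [zero_mul, add_zero, neg_zero, sub_self, sub_zero] at this
  linarith

/-- On an eigenspace the derivatives in `L_c` fall on the kernel, so `L_c` is bounded there. The
constant does not depend on `f`, so the estimate can be iterated. -/
lemma exists_bound (c : ℝ) (μ : ℝ) : ∃ M, 0 ≤ M ∧ ∀ f, AiryEigen c μ f → μ ≠ 0 →
    expNorm (eigenL c μ f) ≤ M * expNorm f ∧ ∀ x, 0 ≤ x → |f x| ≤ M * expNorm f := by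
  obtain ⟨A, hA0, hA⟩ := (rapidDecay_airyKer c).exists_bound one_pos 0
  obtain ⟨B, hB0, hB⟩ := (rapidDecay_airyKer' c).exists_bound one_pos 0
  -- Rate two leaves a spare exponential to absorb the factors `x` and `y` in `x T_c (y f)`.
  obtain ⟨D, hD0, hD⟩ := (rapidDecay_airyKer c).exists_bound two_pos 0
  refine ⟨|μ⁻¹| * (A + B + D), by positivity, fun f hf hμ => ?_⟩
  have hN := expNorm_nonneg f
  have hexp : ∀ x : ℝ, 0 ≤ x → Real.exp (-1 * x) ≤ 1 := fun x hx =>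
    Real.exp_le_one_iff.2 (by linarith)
  have hexp2 : ∀ x : ℝ, x * Real.exp (-2 * x) ≤ Real.exp (-1 * x) := fun x => by
    have h1 := Real.add_one_le_exp x
    have h2 : Real.exp (-1 * x) = Real.exp x * Real.exp (-2 * x) := by
      rw [← Real.exp_add]; ring_nf
    rw [h2]
    exact mul_le_mul_of_nonneg_right (by linarith) (Real.exp_pos _).le
  have h0 : ∀ x, 0 ≤ x → |halfLineOp (airyKer c) f x| ≤ A * expNorm f := fun x hx => by
    refine (abs_halfLineOp_le hf.subExp one_pos hA hx).trans ?_
    exact mul_le_mul_of_nonneg_right (mul_le_of_le_one_right hA0 (hexp x hx)) hN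
  have h1 : ∀ x, 0 ≤ x → |halfLineOp (airyKer' c) f x| ≤ B * expNorm f := fun x hx => by
    refine (abs_halfLineOp_le hf.subExp one_pos hB hx).trans ?_
    exact mul_le_mul_of_nonneg_right (mul_le_of_le_one_right hB0 (hexp x hx)) hN
  have hi : IntegrableOn (fun y => Real.exp (-1 * y) * |f y|) (Ioi 0) := by
    simpa [IntegrableOn] using (hf.subExp 1 one_pos).norm
  have h2 : ∀ x, 0 ≤ x → |x * halfLineOp (airyKer c) (fun y => y * f y) x| ≤ D * expNorm f :=
    fun x hx => by
    have h3 : ∫ y in Ioi (0 : ℝ), Real.exp (-2 * y) * |y * f y| ≤ expNorm f := by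
      have hj : IntegrableOn (fun y => Real.exp (-2 * y) * |y * f y|) (Ioi 0) := by
        simpa only [IntegrableOn, norm_mul, abs_mul, Real.norm_eq_abs, Real.abs_exp] using
          (hf.subExp.id_mul 2 two_pos).norm
      refine setIntegral_mono_on hj hi measurableSet_Ioi fun y hy => ?_
      have hy0 : 0 < y := hy
      rw [abs_mul, abs_of_pos hy0, ← mul_assoc, mul_comm (Real.exp _)]
      exact mul_le_mul_of_nonneg_right (hexp2 y) (abs_nonneg _)
    have h4 := abs_halfLineOp_le hf.subExp.id_mul two_pos hD hx
    rw [abs_mul, abs_of_nonneg hx]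
    calc _ ≤ x * (D * Real.exp (-2 * x) * expNorm f) := by gcongr; exact h4.trans (by gcongr)
      _ = (x * Real.exp (-2 * x)) * (D * expNorm f) := by ring
      _ ≤ 1 * (D * expNorm f) := by
        gcongr; exact (hexp2 x).trans (hexp x hx)
      _ = _ := one_mul _
  constructor
  · have h3 : ∀ x, 0 ≤ x → |eigenL c μ f x| ≤ |μ⁻¹| * (A + B + D) * expNorm f := fun x hx => by
      have : eigenL c μ f x = -(μ⁻¹ * (halfLineOp (airyKer' c) f x
          + x * halfLineOp (airyKer c) (fun y => y * f y) x)) := by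
        rw [eigenL, eigenDeriv, eigenRest]; ring
      rw [this, abs_neg, abs_mul, mul_assoc]
      gcongr
      refine (abs_add_le _ _).trans ?_
      have := h1 x hx
      have := h2 x hx
      have : 0 ≤ A * expNorm f := by positivity
      linarith
    have hexpi : IntegrableOn (fun y : ℝ => Real.exp (-1 * y)) (Ioi 0) :=
      exp_neg_integrableOn_Ioi 0 one_pos
    have hj : IntegrableOn (fun y => Real.exp (-1 * y) * |eigenL c μ f y|) (Ioi 0) := by
      simpa [IntegrableOn] using (hf.rapidDecay_eigenL.subExp 1 one_pos).norm
    calc expNorm (eigenL c μ f) ≤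
        ∫ y in Ioi (0 : ℝ), Real.exp (-1 * y) * (|μ⁻¹| * (A + B + D) * expNorm f) := by
          refine setIntegral_mono_on hj (hexpi.mul_const _) measurableSet_Ioi fun y hy => ?_
          exact mul_le_mul_of_nonneg_left (h3 y (le_of_lt hy)) (Real.exp_pos _).le
      _ = _ := by
          rw [integral_mul_const]
          simp only [neg_one_mul]
          rw [integral_exp_neg_Ioi_zero, one_mul]
  · intro x hx
    rw [hf.eq_inv_mul hμ x, abs_mul, mul_assoc]
    gcongr
    have := h0 x hx
    have : 0 ≤ B * expNorm f := by positivity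
    have : 0 ≤ D * expNorm f := by positivity
    linarith

end AiryEigen

/-! ### Nonvanishing at `0`, simplicity and the recurrence -/

namespace AiryEigen

variable {c μ : ℝ} {f g : ℝ → ℝ}

lemma eigenL_zero (c μ : ℝ) (f : ℝ → ℝ) : eigenL c μ f 0 = -eigenDeriv c μ f 0 := by
  simp [eigenL]

/-- When `f(0) = 0`, the Wronskian relation for `f` and `L_c f` reads `-f'(0)² = 0`. -/
lemma eigenL_zero_eq_zero (hf : AiryEigen c μ f) (hμ : μ ≠ 0) (h0 : f 0 = 0) :
    eigenL c μ f 0 = 0 := by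
  have h := hf.wronskian_zero (hf.eigenL_mem hμ) hμ
  rw [h0, zero_mul, eigenL_zero, mul_neg, neg_eq_zero, mul_self_eq_zero] at h
  rw [eigenL_zero, h, neg_zero]

lemma hasDerivAt_id_mul_eigenDeriv (hf : AiryEigen c μ f) (hμ : μ ≠ 0) (x : ℝ) :
    HasDerivAt (fun x => x * eigenDeriv c μ f x) (x * (x + c) * f x - eigenL c μ f x) x :=
  ((hasDerivAt_id x).mul (hf.hasDerivAt_eigenDeriv hμ x)).congr_deriv (by
    simp only [eigenL, id]; ring)

lemma hasDerivAt_pow_div_factorial (K : ℝ) (j : ℕ) (x : ℝ) :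
    HasDerivAt (fun x : ℝ => K * (x ^ (j + 1) / (j + 1).factorial))
      (K * (x ^ j / j.factorial)) x := by
  refine (((hasDerivAt_pow (j + 1) x).div_const _).const_mul K).congr_deriv ?_
  rw [Nat.factorial_succ]
  push_cast
  have : (j.factorial : ℝ) ≠ 0 := by positivity
  field_simp

/-- An eigenfunction of `T_c` that vanishes at `0` vanishes on the half-line. -/
lemma eq_zero_of_zero (hf : AiryEigen c μ f) (hμ : μ ≠ 0) (h0 : f 0 = 0) {X : ℝ} (hX : 0 ≤ X) :
    f X = 0 := by
  obtain ⟨M, hM0, hM⟩ := exists_bound c μ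
  have hu : ∀ n : ℕ, AiryEigen c μ ((eigenL c μ)^[n] f) ∧ (eigenL c μ)^[n] f 0 = 0 ∧
      expNorm ((eigenL c μ)^[n] f) ≤ M ^ n * expNorm f := by
    intro n
    induction n with
    | zero => simpa using ⟨hf, h0⟩
    | succ n ih =>
      rw [Function.iterate_succ_apply']
      refine ⟨ih.1.eigenL_mem hμ, ih.1.eigenL_zero_eq_zero hμ ih.2.1,
        (hM _ ih.1 hμ).1.trans ?_⟩
      rw [pow_succ', mul_assoc]
      exact mul_le_mul_of_nonneg_left ih.2.2 hM0
  set N := expNorm f with hN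
  have hN0 : 0 ≤ N := expNorm_nonneg f
  set Q : ℝ := X * (X + |c|) with hQ
  have hQ0 : 0 ≤ Q := by positivity
  -- The step from `j` to `j + 1` uses the bounds at `j` for both `n` and `n + 1`: `Q` bounds `x (x
  -- + c)` on `[0, X]`, and `M` pays for the shift in `n`.
  have key : ∀ j n : ℕ, ∀ x ∈ Icc 0 X, |(eigenL c μ)^[n] f x|
      ≤ M * N * M ^ n * (Q + M) ^ j * (x ^ j / j.factorial) := by
    intro j
    induction j with
    | zero =>
      intro n x hx
      have h1 := (hM _ (hu n).1 hμ).2 x hx.1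
      have h2 := mul_le_mul_of_nonneg_left (hu n).2.2 hM0
      simp only [pow_zero, Nat.factorial_zero, Nat.cast_one, div_one, mul_one]
      linarith
    | succ j ih =>
      intro n
      set K := M * N * M ^ n * (Q + M) ^ j with hK
      have hK0 : 0 ≤ K := by positivity
      have hn := (hu n).1
      have hrhs : ∀ x ∈ Icc 0 X, |x * (x + c) * (eigenL c μ)^[n] f x
          - eigenL c μ ((eigenL c μ)^[n] f) x| ≤ K * (Q + M) * (x ^ j / j.factorial) := by
        intro x hx
        have h1 := ih n x hx
        have h2 := ih (n + 1) x hx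
        rw [Function.iterate_succ_apply'] at h2
        have h3 : |x * (x + c)| ≤ Q := by
          rw [abs_mul, abs_of_nonneg hx.1, hQ]
          have h4 : |x + c| ≤ X + |c| := (abs_add_le _ _).trans (by
            rw [abs_of_nonneg hx.1]; linarith [hx.2])
          exact mul_le_mul hx.2 h4 (abs_nonneg _) hX
        calc _ ≤ |x * (x + c) * (eigenL c μ)^[n] f x|
              + |eigenL c μ ((eigenL c μ)^[n] f) x| := abs_sub _ _
          _ ≤ Q * (K * (x ^ j / j.factorial))
              + M * N * M ^ (n + 1) * (Q + M) ^ j * (x ^ j / j.factorial) := by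
            rw [abs_mul]
            gcongr
          _ = _ := by rw [hK]; ring
      have hd : ∀ x ∈ Icc 0 X, |x * eigenDeriv c μ ((eigenL c μ)^[n] f) x|
          ≤ K * (Q + M) * (x ^ (j + 1) / (j + 1).factorial) :=
        image_norm_le_of_norm_deriv_right_le_deriv_boundary
          (fun x _ => (hn.hasDerivAt_id_mul_eigenDeriv hμ x).continuousAt.continuousWithinAt)
          (fun x _ => (hn.hasDerivAt_id_mul_eigenDeriv hμ x).hasDerivWithinAt) (by simp)
          (hasDerivAt_pow_div_factorial _ j) (fun x hx => hrhs x ⟨hx.1, hx.2.le⟩)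
      -- Division by `x` costs one power, which the next integration restores; the gain `1 / (j +
      -- 1)` from the first integration is discarded. At `x = 0` the derivative is zero.
      have hd' : ∀ x ∈ Icc 0 X, |eigenDeriv c μ ((eigenL c μ)^[n] f) x|
          ≤ K * (Q + M) * (x ^ j / j.factorial) := by
        intro x hx
        rcases hx.1.eq_or_lt with rfl | hx0
        · have := hn.eigenL_zero_eq_zero hμ (hu n).2.1
          rw [eigenL_zero, neg_eq_zero] at this
          rw [this, abs_zero]; positivity
        · have h1 := hd x hx
          rw [abs_mul, abs_of_pos hx0] at h1
          refine le_of_mul_le_mul_left (h1.trans ?_) hx0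
          rw [pow_succ, mul_left_comm]
          have : x ^ j * x / ((j + 1).factorial : ℝ) ≤ x * (x ^ j / j.factorial) := by
            rw [mul_comm (x ^ j), mul_div_assoc]
            gcongr
            exact Nat.le_succ j
          exact mul_le_mul_of_nonneg_left this (by positivity)
      have hfin : ∀ x ∈ Icc 0 X, |(eigenL c μ)^[n] f x|
          ≤ K * (Q + M) * (x ^ (j + 1) / (j + 1).factorial) :=
        image_norm_le_of_norm_deriv_right_le_deriv_boundary
          (fun x _ => (hn.hasDerivAt hμ x).continuousAt.continuousWithinAt)
          (fun x _ => (hn.hasDerivAt hμ x).hasDerivWithinAt) (by simp [(hu n).2.1])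
          (hasDerivAt_pow_div_factorial _ j) (fun x hx => hd' x ⟨hx.1, hx.2.le⟩)
      intro x hx
      refine (hfin x hx).trans (le_of_eq ?_)
      rw [hK]; ring
  have hlim : Tendsto (fun j : ℕ => M * N * (((Q + M) * X) ^ j / j.factorial)) atTop (𝓝 0) := by
    simpa using (FloorSemiring.tendsto_pow_div_factorial_atTop ((Q + M) * X)).const_mul (M * N)
  have hle : |f X| ≤ 0 := by
    refine ge_of_tendsto' hlim fun j => (key j 0 X ⟨hX, le_rfl⟩).trans (le_of_eq ?_)
    rw [mul_pow]; ring
  exact abs_nonpos_iff.1 hle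

lemma linear_comb (hf : AiryEigen c μ f) (hg : AiryEigen c μ g) (a b : ℝ) :
    AiryEigen c μ (fun x => a * f x + b * g x) := by
  refine ⟨fun d hd => ?_, fun x => ?_⟩
  · refine (((hf.subExp d hd).const_mul a).add ((hg.subExp d hd).const_mul b)).congr
      (Eventually.of_forall fun y => ?_)
    simp only [Pi.add_apply]; ring
  · have i1 := hf.subExp.integrableOn_kernel_mul (rapidDecay_airyKer c) x
    have i2 := hg.subExp.integrableOn_kernel_mul (rapidDecay_airyKer c) x
    have : halfLineOp (airyKer c) (fun x => a * f x + b * g x) x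
        = a * halfLineOp (airyKer c) f x + b * halfLineOp (airyKer c) g x := by
      rw [halfLineOp, halfLineOp, halfLineOp, ← integral_const_mul, ← integral_const_mul,
        ← integral_add (i1.const_mul a) (i2.const_mul b)]
      congr 1; ext y; ring
    rw [this, ← hf.eigen, ← hg.eigen]; ring

/-- The eigenvalues of `T_c` are simple. -/
lemma mul_eq_mul (hf : AiryEigen c μ f) (hg : AiryEigen c μ g) (hμ : μ ≠ 0) {x : ℝ}
    (hx : 0 ≤ x) : f 0 * g x = g 0 * f x := by
  have := (hg.linear_comb hf (f 0) (-g 0)).eq_zero_of_zero hμ (by ring) hx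
  linarith

/-- `L_c f` lies in the eigenspace of `f`, which is one-dimensional; the value at `0` fixes the
factor. -/
lemma exists_eigenL_eq (hf : AiryEigen c μ f) (hμ : μ ≠ 0) (h0 : f 0 ≠ 0) :
    ∃ χ, ∀ x, 0 ≤ x → eigenL c μ f x = χ * f x := by
  refine ⟨eigenL c μ f 0 / f 0, fun x hx => ?_⟩
  have := hf.mul_eq_mul (hf.eigenL_mem hμ) hμ hx
  field_simp
  linarith

/-- The differential equation, differentiated `k` times. -/
lemma recurrence (hf : AiryEigen c μ f) (hμ : μ ≠ 0) {χ : ℝ}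
    (hχ : ∀ x, 0 ≤ x → eigenL c μ f x = χ * f x) (k : ℕ) :
    ∀ x, 0 ≤ x → -((k : ℝ) * (k - 1)) * iteratedDeriv (k - 2) f x
      - k * (c + 2 * x) * iteratedDeriv (k - 1) f x
      + (χ - c * x - x ^ 2) * iteratedDeriv k f x + (k + 1) * iteratedDeriv (k + 1) f x
      + x * iteratedDeriv (k + 2) f x = 0 := by
  have hd : ∀ m x, HasDerivAt (iteratedDeriv m f) (iteratedDeriv (m + 1) f x) x := fun m x => by
    rw [iteratedDeriv_succ]
    refine (((hf.contDiff hμ).differentiable_iteratedDeriv m ?_) x).hasDerivAt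
    exact_mod_cast WithTop.coe_lt_coe.2 (WithTop.coe_lt_top m)
  have hlin : ∀ x : ℝ, HasDerivAt (fun x => c + 2 * x) 2 x := fun x => by
    simpa using ((hasDerivAt_id x).const_mul 2).const_add c
  have hquad : ∀ x : ℝ, HasDerivAt (fun x => χ - c * x - x ^ 2) (-(c + 2 * x)) x := fun x =>
    (((hasDerivAt_const x χ).sub ((hasDerivAt_id x).const_mul c)).sub
      (hasDerivAt_pow 2 x)).congr_deriv (by simp; ring)
  induction k with
  | zero =>
    intro x hx
    have h1 : iteratedDeriv 1 f = eigenDeriv c μ f := by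
      rw [iteratedDeriv_one]; exact funext fun x => (hf.hasDerivAt hμ x).deriv
    have h2 : iteratedDeriv 2 f x = (x + c) * f x + eigenRest c μ f x := by
      rw [iteratedDeriv_succ, h1]; exact (hf.hasDerivAt_eigenDeriv hμ x).deriv
    have h3 := hχ x hx
    rw [eigenL] at h3
    simp only [zero_add, h1, h2, iteratedDeriv_zero]
    push_cast
    linarith
  | succ k ih =>
    intro x hx
    refine HasDerivAt.eq_zero_of_eqOn_Ici ?_ ih hx
    have h1 : HasDerivAt (fun x => -((k : ℝ) * (k - 1)) * iteratedDeriv (k - 2) f x)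
        (-((k : ℝ) * (k - 1)) * iteratedDeriv (k - 1) f x) x := by
      -- For `k = 0, 1` the truncated index `k - 2` is harmless, since the coefficient `k (k - 1)`
      -- is zero.
      match k with
      | 0 => simpa using hasDerivAt_const x (0 : ℝ)
      | 1 => simpa using hasDerivAt_const x (0 : ℝ)
      | k + 2 => exact (hd k x).const_mul _
    have h2 : HasDerivAt (fun x => (k : ℝ) * (c + 2 * x) * iteratedDeriv (k - 1) f x)
        ((k : ℝ) * 2 * iteratedDeriv (k - 1) f x + (k : ℝ) * (c + 2 * x) * iteratedDeriv k f x)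
        x := by
      match k with
      | 0 => simpa using hasDerivAt_const x (0 : ℝ)
      | k + 1 => exact ((hlin x).const_mul _).mul (hd k x)
    have h3 := (hquad x).mul (hd k x)
    have h4 := (hd (k + 1) x).const_mul ((k : ℝ) + 1)
    have h5 := (hasDerivAt_id x).mul (hd (k + 2) x)
    refine ((((h1.sub h2).add h3).add h4).add h5).congr_deriv ?_
    simp only [id, Nat.add_sub_cancel, show k + 1 - 2 = k - 1 by omega]
    push_cast
    ring

end AiryEigen

/-! ### From half-line eigenfunctions to their extensions, and the theorem -/

lemma restrict_Ici_zero : volume.restrict (Ici (0 : ℝ)) = volume.restrict (Ioi 0) :=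
  (restrict_Ioi_eq_restrict_Ici).symm

namespace IsAiryEigenfunction

variable {c μ : ℝ} {f : ℝ → ℝ}

lemma subExp (hf : IsAiryEigenfunction c μ f) : SubExp f :=
  .of_memLp (restrict_Ici_zero ▸ hf.memLp)

lemma eigen_halfLineOp (hf : IsAiryEigenfunction c μ f) {x : ℝ} (hx : 0 ≤ x) :
    μ * f x = halfLineOp (airyKer c) f x := by
  rw [hf.eigen x hx, airyT, restrict_Ici_zero]; rfl

lemma eigenvalue_ne_zero (hf : IsAiryEigenfunction c μ f) : μ ≠ 0 := by
  rintro rfl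
  refine hf.ne_zero ?_
  rw [restrict_Ici_zero]
  exact ae_eq_zero_of_airyOp_eq_zero hf.subExp fun x hx => by
    rw [← hf.eigen_halfLineOp hx, zero_mul]

/-- Every eigenfunction of `T_c` extends smoothly to the whole line. -/
lemma exists_extension (hf : IsAiryEigenfunction c μ f) :
    ∃ F, AiryEigen c μ F ∧ EqOn f F (Ici 0) := by
  have hμ := hf.eigenvalue_ne_zero
  have heq : ∀ x, 0 ≤ x → f x = μ⁻¹ * halfLineOp (airyKer c) f x := fun x hx => by
    rw [← hf.eigen_halfLineOp hx]; field_simp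
  -- The integral makes sense at every real `x` and sees `f` only on the half-line, so replacing `f`
  -- by the extension does not change it.
  refine ⟨fun x => μ⁻¹ * halfLineOp (airyKer c) f x,
    ⟨((rapidDecay_airyOp hf.subExp).const_mul _).subExp, fun x => ?_⟩, fun x hx => heq x hx⟩
  rw [mul_inv_cancel_left₀ hμ]
  refine setIntegral_congr_fun measurableSet_Ioi fun y hy => ?_
  simp only [← heq y (le_of_lt hy)]

lemma apply_zero_ne_zero (hf : IsAiryEigenfunction c μ f) : f 0 ≠ 0 := by
  obtain ⟨F, hF, he⟩ := hf.exists_extension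
  intro h0
  refine hf.ne_zero ((ae_restrict_mem measurableSet_Ici).mono fun x hx => ?_)
  rw [he hx]
  exact hF.eq_zero_of_zero hf.eigenvalue_ne_zero (by rw [← he self_mem_Ici, h0]) hx

end IsAiryEigenfunction

namespace AiryEigen

variable {c μ : ℝ} {f F : ℝ → ℝ}

lemma airyL_eq (hF : AiryEigen c μ F) (hμ : μ ≠ 0) (he : EqOn f F (Ici 0)) {x : ℝ}
    (hx : 0 ≤ x) : airyL c f x = eigenL c μ F x := by
  have h1 : ∀ t ∈ Ici (0 : ℝ), t * derivWithin f (Ici 0) t = t * eigenDeriv c μ F t :=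
    fun t ht => by
      rw [derivWithin_congr he (he ht),
        (hF.hasDerivAt hμ t).hasDerivWithinAt.derivWithin (uniqueDiffOn_Ici 0 t ht)]
  rw [airyL, derivWithin_congr h1 (h1 x hx), (hF.hasDerivAt_id_mul_eigenDeriv hμ x
    ).hasDerivWithinAt.derivWithin (uniqueDiffOn_Ici 0 x hx), he hx]
  ring

lemma halfLineDeriv_eq (hF : AiryEigen c μ F) (hμ : μ ≠ 0) (he : EqOn f F (Ici 0)) (k : ℕ)
    {x : ℝ} (hx : 0 ≤ x) : halfLineDeriv k f x = iteratedDeriv k F x := by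
  rw [halfLineDeriv, iteratedDerivWithin_congr he hx,
    iteratedDerivWithin_eq_iteratedDeriv (uniqueDiffOn_Ici 0)
      (((hF.contDiff hμ).of_le (by exact_mod_cast le_top)).contDiffAt) hx]

end AiryEigen

theorem theoremA2 (c : ℝ) (lam : ℕ → ℝ) (ψ : ℕ → ℝ → ℝ) (hψ : IsAiryEigensystem c lam ψ) :
    (∀ n, ContDiffOn ℝ ∞ (ψ n) (Set.Ici 0)) ∧
    (∃! χ : ℕ → ℝ, IsAiryChi c ψ χ) ∧
    ∀ χ : ℕ → ℝ, IsAiryChi c ψ χ → ∀ n : ℕ,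
      (∀ k : ℕ, 2 ≤ k → ∀ x : ℝ, 0 ≤ x →
        - ((k : ℝ) * ((k : ℝ) - 1)) * halfLineDeriv (k - 2) (ψ n) x
          - (k : ℝ) * (c + 2 * x) * halfLineDeriv (k - 1) (ψ n) x
          + (χ n - c * x - x ^ 2) * halfLineDeriv k (ψ n) x
          + ((k : ℝ) + 1) * halfLineDeriv (k + 1) (ψ n) x
          + x * halfLineDeriv (k + 2) (ψ n) x = 0) ∧
      (∀ x : ℝ, 0 ≤ x →
        - (c + 2 * x) * ψ n x
          + (χ n - c * x - x ^ 2) * halfLineDeriv 1 (ψ n) x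
          + 2 * halfLineDeriv 2 (ψ n) x
          + x * halfLineDeriv 3 (ψ n) x = 0) ∧
      χ n * ψ n 0 + halfLineDeriv 1 (ψ n) 0 = 0 ∧
      (0 < c → ψ n 0 ≠ 0) := by
  have hμ := fun n => (hψ.eigenfunction n).eigenvalue_ne_zero
  have h0 := fun n => (hψ.eigenfunction n).apply_zero_ne_zero
  choose F hF he using fun n => (hψ.eigenfunction n).exists_extension
  refine ⟨fun n => ((hF n).contDiff (hμ n)).contDiffOn.congr (he n), ?_, fun χ hχ n => ?_⟩
  · choose χ hχ using fun n => (hF n).exists_eigenL_eq (hμ n) (he n self_mem_Ici ▸ h0 n)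
    have hχ' : IsAiryChi c ψ χ := fun n x hx => by
      rw [(hF n).airyL_eq (hμ n) (he n) hx, hχ n x hx, he n hx]
    refine ⟨χ, hχ', fun χ' h' => funext fun n => mul_right_cancel₀ (h0 n) ?_⟩
    rw [← h' n 0 le_rfl, hχ' n 0 le_rfl]
  · have hode : ∀ x, 0 ≤ x → eigenL c (lam n) (F n) x = χ n * F n x := fun x hx => by
      rw [← (hF n).airyL_eq (hμ n) (he n) hx, hχ n x hx, he n hx]
    have hD := fun k x hx => (hF n).halfLineDeriv_eq (hμ n) (he n) k (x := x) hx
    have hrec := (hF n).recurrence (hμ n) hode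
    -- The second identity is the recurrence at `k = 1`, the third is `k = 0` at `x = 0`.
    refine ⟨fun k _ x hx => ?_, fun x hx => ?_, ?_, fun _ => h0 n⟩
    · simpa only [hD _ x hx] using hrec k x hx
    · have := hrec 1 x hx
      rw [hD _ x hx, hD _ x hx, hD _ x hx, he n hx, iteratedDeriv_one]
      norm_num at this
      linarith
    · have := hrec 0 0 le_rfl
      rw [hD _ 0 le_rfl, he n self_mem_Ici, iteratedDeriv_one]
      norm_num at this
      linarith
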